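/- **Setting.** Let $\mathcal C$ be a skeletally small preadditive category and let $\mathrm{Mod}(\mathcal C)$ be the category of additive contravariant functors from $\mathcal C$ to abelian groups. A $\mathcal C$-module $M$ is *finitely presented* if there is an exact sequence $\coprod_{i=1}^{n}\mathcal C(-,X_i)\to\coprod_{j=1}^{m}\mathcal C(-,Y_j)\to M\to 0$ with $n,m$ finite. A skeletally small full subcategory $\mathcal T$ of $\mathrm{Mod}(\mathcal C)$ is called *tilting* if 1. every object of $\mathcal T$ is finitely presented and has projective dimension at most $1$; 2. $\mathrm{Ext}^1_{\mathcal C}(T,T')=0$ for all $T,T'\in\mathcal T$; 3. for every object $X$ of $\mathcal C$ there is an exact sequence $0\to\mathcal C(-,X)\to T_1\to T_2\to 0$ with $T_1,T_2\in\mathcal T$. Let $\mathcal T$ be a tilting subcategory of $\mathrm{Mod}(\mathcal C)$. Define functors $F,F':\mathrm{Mod}(\mathcal C)\to\mathrm{Mod}(\mathcal T)$ by $$F(M)=\mathrm{Hom}_{\mathcal C}(-,M)|_{\mathcal T},\qquad F'(M)=\mathrm{Ext}^1_{\mathcal C}(-,M)|_{\mathcal T},$$ and functors $G,G':\mathrm{Mod}(\mathcal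 T)\to\mathrm{Mod}(\mathcal C)$ by $$G(N)=N\otimes\mathcal T,\qquad G'(N)=\mathrm{Tor}_1^{\mathcal T}(N,\mathcal T),$$ where $-\otimes\mathcal T$ is the left adjoint of $F$ and $\mathrm{Tor}_1^{\mathcal T}(-,\mathcal T)$ is the first left derived functor of $-\otimes\mathcal T$. Let $\mathscr T\subseteq\mathrm{Mod}(\mathcal C)$ be the class of all epimorphic images of (arbitrary set-indexed) direct sums of objects of $\mathcal T$, and let $\mathscr F=\{N\in\mathrm{Mod}(\mathcal C) : \mathrm{Hom}_{\mathcal C}(M,N)=0\text{ for all }M\in\mathscr T\}$. In $\mathrm{Mod}(\mathcal T)$ let $$\mathscr X=\{N : N\otimes\mathcal T=0\},\qquad \mathscr Y=\{N : \mathrm{Tor}_1^{\mathcal T}(N,\mathcal T)=0\}.$$ All of these classes are regarded as full subcategories. **Theorem (Brenner–Butler).** With the above notation, the following statements are true. - (i) $F$ and $G$ induce an equivalence between $\mathscr T$ and $\mathscr Y$: $F$ maps $\mathscr T$ into $\mathscr Y$, $G$ maps $\mathscr Y$ into $\mathscr T$, and the restricted functors are mutually quasi-inverse. - (ii) $F'$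 and $G'$ induce, in the same sense, an equivalence between $\mathscr F$ and $\mathscr X$. - (iii) $FG'=F'G=0$ and $G'F=GF'=0$. Moreover, $(\mathscr X,\mathscr Y)$ is a torsion theory in $\mathrm{Mod}(\mathcal T)$: $\mathrm{Hom}_{\mathcal T}(X,Y)=0$ for all $X\in\mathscr X$ and $Y\in\mathscr Y$; each of the two classes contains every module that satisfies this vanishing with respect to all modules of the other class; and every $N\in\mathrm{Mod}(\mathcal T)$ fits into an exact sequence $0\to X\to N\to Y\to 0$ with $X\in\mathscr X$ and $Y\in\mathscr Y$. -/

import Mathlib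

open CategoryTheory CategoryTheory.Limits Opposite

universe w v u v' u'

/-- The category `Mod(C)` of `C`-modules: additive contravariant functors from `C` to abelian
groups. Here `C` will be skeletally small with respect to the universe `w` of the abelian groups. -/
abbrev CatMod (C : Type u) [Category.{v} C] [Preadditive C] : Type (max (max u v) (w + 1)) :=
  Cᵒᵖ ⥤+ AddCommGrpCat.{w}

namespace CatMod

section Closed

variable {A : Type u} [Category.{v} A] [Preadditive A]

instance closedLimits (J : Type u') [Category.{v'} J] [HasLimitsOfShape J AddCommGrpCat.{w}] :
    (additiveFunctor A AddCommGrpCat.{w}).IsClosedUnderLimitsOfShape J where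
  limitsOfShape_le := by
    rintro F ⟨p⟩
    refine ⟨fun {X Y f g} => ?_⟩
    refine (isLimitOfPreserves ((evaluation A AddCommGrpCat.{w}).obj Y) p.isLimit).hom_ext
      fun j => ?_
    have := p.prop_diag_obj j
    have h : (p.diag.obj j).Additive := this
    dsimp
    simp [Preadditive.add_comp]

instance closedColimits (J : Type u') [Category.{v'} J] [HasColimitsOfShape J AddCommGrpCat.{w}] :
    (additiveFunctor A AddCommGrpCat.{w}).IsClosedUnderColimitsOfShape J where
  colimitsOfShape_le := by
    rintro F ⟨p⟩
    refine ⟨fun {X Y f g} => ?_⟩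
    refine (isColimitOfPreserves ((evaluation A AddCommGrpCat.{w}).obj X) p.isColimit).hom_ext
      fun j => ?_
    have h : (p.diag.obj j).Additive := p.prop_diag_obj j
    dsimp
    simp only [← NatTrans.naturality, Preadditive.comp_add, Functor.map_add, Preadditive.add_comp]

instance : (additiveFunctor A AddCommGrpCat.{w}).ContainsZero where
  exists_zero := ⟨(Functor.const A).obj (AddCommGrpCat.of PUnit.{w + 1}),
    (Functor.isZero_iff _).2 fun _ =>
      AddCommGrpCat.isZero_of_subsingleton (AddCommGrpCat.of PUnit.{w + 1}),
    ⟨(AddCommGrpCat.isZero_of_subsingleton (AddCommGrpCat.of PUnit.{w + 1})).eq_of_src _ _⟩⟩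

instance : (additiveFunctor A AddCommGrpCat.{w}).IsClosedUnderFiniteProducts where

instance : (additiveFunctor A AddCommGrpCat.{w}).IsClosedUnderKernels where
  kernels_le := by
    rintro _ ⟨f, k, hk, hf⟩
    refine (additiveFunctor A AddCommGrpCat.{w}).prop_of_isLimit hk ?_
    rintro (_ | _)
    exacts [hf.1, hf.2]

instance : (additiveFunctor A AddCommGrpCat.{w}).IsClosedUnderCokernels where
  cokernels_le := by
    rintro _ ⟨f, k, hk, hf⟩
    refine (additiveFunctor A AddCommGrpCat.{w}).prop_of_isColimit hk ?_
    rintro (_ | _)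
    exacts [hf.1, hf.2]

end Closed
section
variable (C : Type u) [Category.{v} C] [Preadditive C]
noncomputable instance : Abelian (CatMod.{w} C) := inferInstance
instance : HasLimitsOfSize.{w, w} (CatMod.{w} C) :=
  ⟨fun _ _ => inferInstance⟩
instance : HasColimitsOfSize.{w, w} (CatMod.{w} C) :=
  ⟨fun _ _ => inferInstance⟩

instance [EssentiallySmall.{w} C] : LocallySmall.{w} (CatMod.{w} C) := by
  have : LocallySmall.{w} (Cᵒᵖ ⥤ AddCommGrpCat.{w}) := 
    (locallySmall_congr (equivSmallModel.{w} Cᵒᵖ).congrLeft).2 inferInstance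
  infer_instance

end

section Hom

variable {A : Type u} [Category.{v} A] [Preadditive A]
variable {B : Type u'} [Category.{v'} B] [Preadditive B] [LocallySmall.{w} B]

/-- The `A`-module `X ↦ Hom(J X, M)` attached to an additive functor `J : A ⥤ B` and an object `M`
of `B`. The hom groups are replaced by isomorphic copies in the universe `w`. -/
noncomputable def homModule (J : A ⥤ B) [J.Additive] (M : B) : CatMod.{w} A where
  obj :=
    { obj X := AddCommGrpCat.of (Shrink.{w} (J.obj X.unop ⟶ M))
      map {X Y} f := AddCommGrpCat.ofHom (AddMonoidHom.mk'
        (fun a => equivShrink _ (J.map f.unop ≫ (equivShrink _).symm a))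
        (fun a b => by simp [equivShrink_symm_add, equivShrink_add]))
      map_id X := by ext a; simp
      map_comp f g := by ext a; simp }
  property := ⟨fun {X Y f g} => by ext a; simp [equivShrink_add, Preadditive.add_comp]⟩

/-- The functor `M ↦ Hom(J -, M)` from `B` to `A`-modules. -/
noncomputable def homFunctor (J : A ⥤ B) [J.Additive] : B ⥤ CatMod.{w} A where
  obj M := homModule J M
  map {M N} g := ObjectProperty.homMk
    { app X := AddCommGrpCat.ofHom (AddMonoidHom.mk'
        (fun a => equivShrink _ ((equivShrink (J.obj X.unop ⟶ M)).symm a ≫ g))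
        (fun a b => by simp [equivShrink_symm_add, equivShrink_add]))
      naturality X Y f := by
        ext a
        change equivShrink (J.obj Y.unop ⟶ N) ((equivShrink (J.obj Y.unop ⟶ M)).symm
          (equivShrink _ (J.map f.unop ≫ (equivShrink (J.obj X.unop ⟶ M)).symm a)) ≫ g) =
          equivShrink _ (J.map f.unop ≫ (equivShrink (J.obj X.unop ⟶ N)).symm
            (equivShrink _ ((equivShrink (J.obj X.unop ⟶ M)).symm a ≫ g)))
        simp }
  map_id M := by
    ext X a
    change equivShrink (J.obj X.unop ⟶ M) ((equivShrink (J.obj X.unop ⟶ M)).symm a ≫ 𝟙 M) = a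
    rw [Category.comp_id]
    exact (equivShrink (J.obj X.unop ⟶ M)).apply_symm_apply a
  map_comp {M N P} f g := by
    ext X a
    change equivShrink (J.obj X.unop ⟶ P) ((equivShrink (J.obj X.unop ⟶ M)).symm a ≫ f ≫ g) =
      equivShrink _ ((equivShrink (J.obj X.unop ⟶ N)).symm
        (equivShrink _ ((equivShrink (J.obj X.unop ⟶ M)).symm a ≫ f)) ≫ g)
    simp

/-- Elements of `Hom(J X, M)`. -/
noncomputable def homElem (J : A ⥤ B) [J.Additive] (M : B) (X : A) :
    (J.obj X ⟶ M) ≃ ((homFunctor J).obj M).obj.obj (op X) :=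
  equivShrink _

lemma map_homElem (J : A ⥤ B) [J.Additive] {M : B} {X Y : A} (f : X ⟶ Y) (a : J.obj Y ⟶ M) :
    (((homFunctor J).obj M).obj.map f.op) (homElem.{w} J M Y a) = homElem J M X (J.map f ≫ a) := by
  change equivShrink _ (J.map f ≫ (equivShrink _).symm (equivShrink _ a)) = equivShrink _ _
  simp

lemma homFunctor_map_homElem (J : A ⥤ B) [J.Additive] {M N : B} (g : M ⟶ N) {X : A}
    (a : J.obj X ⟶ M) :
    (((homFunctor J).map g).hom.app (op X)) (homElem.{w} J M X a) = homElem J N X (a ≫ g) := by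
  change equivShrink _ ((equivShrink _).symm (equivShrink _ a) ≫ g) = equivShrink _ _
  simp

lemma homElem_add (J : A ⥤ B) [J.Additive] {M : B} {X : A} (a b : J.obj X ⟶ M) :
    homElem.{w} J M X (a + b) = homElem J M X a + homElem J M X b :=
  equivShrink_add _ _

instance (J : A ⥤ B) [J.Additive] : (homFunctor.{w} J).Additive where
  map_add {M N f g} := by
    ext X a
    obtain ⟨a, rfl⟩ := (homElem J M X.unop).surjective a
    change ((homFunctor J).map (f + g)).hom.app (op X.unop) _ =
      ((homFunctor J).map f).hom.app (op X.unop) _ + ((homFunctor J).map g).hom.app (op X.unop) _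
    simp only [homFunctor_map_homElem, Preadditive.comp_add, homElem_add]

end Hom

section Epi

variable {C : Type u} [Category.{v} C] [Preadditive C]

lemma surjective_app_of_epi {N N' : CatMod.{w} C} (g : N ⟶ N') [Epi g] (X : Cᵒᵖ) :
    Function.Surjective (g.hom.app X) := by
  have : Epi ((AdditiveFunctor.forget _ _).map g) := inferInstance
  have : Epi (g.hom.app X) := inferInstanceAs (Epi (((AdditiveFunctor.forget _ _).map g).app X))
  exact (AddCommGrpCat.epi_iff_surjective _).1 this

end Epi

section Repr

variable {C : Type u} [Category.{v} C] [Preadditive C] [LocallySmall.{w} C]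

/-- The representable module `C(-, X)`. -/
noncomputable abbrev repr (X : C) : CatMod.{w} C := (homFunctor.{w} (𝟭 C)).obj X

/-- The Yoneda lemma. -/
noncomputable def yonedaEquiv (X : C) (N : CatMod.{w} C) :
    (repr.{w} X ⟶ N) ≃ N.obj.obj (op X) where
  toFun f := f.hom.app (op X) (homElem (𝟭 C) X X (𝟙 X))
  invFun x := ObjectProperty.homMk
    { app Y := AddCommGrpCat.ofHom (AddMonoidHom.mk'
        (fun a => N.obj.map (((homElem.{w} (𝟭 C) X Y.unop).symm a).op) x) (fun a b => by
          obtain ⟨a, rfl⟩ := (homElem (𝟭 C) X Y.unop).surjective a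
          obtain ⟨b, rfl⟩ := (homElem (𝟭 C) X Y.unop).surjective b
          erw [← homElem_add]
          simp))
      naturality Y Z f := by
        ext a
        obtain ⟨a, rfl⟩ := (homElem (𝟭 C) X Y.unop).surjective a
        change N.obj.map ((homElem.{w} (𝟭 C) X Z.unop).symm
          ((repr.{w} X).obj.map f.unop.op (homElem (𝟭 C) X Y.unop a))).op x =
          N.obj.map f (N.obj.map ((homElem.{w} (𝟭 C) X Y.unop).symm _).op x)
        rw [map_homElem]
        simp }
  left_inv f := by
    ext Y a
    obtain ⟨a, rfl⟩ := (homElem (𝟭 C) X Y.unop).surjective a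
    change N.obj.map ((homElem.{w} (𝟭 C) X Y.unop).symm (homElem (𝟭 C) X Y.unop a)).op
      (f.hom.app (op X) _) = _
    rw [Equiv.symm_apply_apply, ← NatTrans.naturality_apply, map_homElem]
    simp
  right_inv x := by
    change N.obj.map ((homElem.{w} (𝟭 C) X X).symm (homElem (𝟭 C) X X (𝟙 X))).op x = _
    simp

lemma yonedaEquiv_comp {X : C} {N N' : CatMod.{w} C} (f : repr.{w} X ⟶ N) (g : N ⟶ N') :
    yonedaEquiv X N' (f ≫ g) = g.hom.app (op X) (yonedaEquiv X N f) := rfl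

lemma yonedaEquiv_symm_comp {X : C} {N N' : CatMod.{w} C} (x : N.obj.obj (op X)) (g : N ⟶ N') :
    (yonedaEquiv X N).symm x ≫ g = (yonedaEquiv X N').symm (g.hom.app (op X) x) :=
  (yonedaEquiv X N').injective (by simp [yonedaEquiv_comp])

instance (X : C) : Projective (repr.{w} X) where
  factors {N' N} f e _ := by
    obtain ⟨x, hx⟩ := surjective_app_of_epi e (op X) (yonedaEquiv _ _ f)
    exact ⟨(yonedaEquiv _ _).symm x, by rw [yonedaEquiv_symm_comp, hx, Equiv.symm_apply_apply]⟩

end Repr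

section Cover

variable {C : Type u} [Category.{v} C] [Preadditive C] [EssentiallySmall.{w} C]

/-- The family of representable modules indexed by all elements of a module. -/
noncomputable abbrev coverFamily (N : CatMod.{w} C)
    (i : Σ X : SmallModel.{w} C, N.obj.obj (op ((equivSmallModel C).inverse.obj X))) :
    CatMod.{w} C :=
  repr.{w} ((equivSmallModel C).inverse.obj i.1)

/-- The sum of representable modules which canonically covers a module. -/
noncomputable abbrev cover (N : CatMod.{w} C) : CatMod.{w} C := ∐ coverFamily N

/-- The canonical map onto a module from a sum of representable modules. -/
noncomputable def coverπ (N : CatMod.{w} C) : cover N ⟶ N :=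
  Sigma.desc fun i => (yonedaEquiv _ N).symm i.2

instance (N : CatMod.{w} C) : Epi (coverπ N) where
  left_cancellation {Z} f g h := by
    have key (X : SmallModel.{w} C) (x : N.obj.obj (op ((equivSmallModel C).inverse.obj X))) :
        f.hom.app _ x = g.hom.app _ x := by
      have hk : Sigma.ι (coverFamily N) ⟨X, x⟩ ≫ coverπ N = (yonedaEquiv _ N).symm x :=
        Sigma.ι_desc _ _
      have := congrArg (fun l => Sigma.ι (coverFamily N) ⟨X, x⟩ ≫ l) h
      simp only [← Category.assoc, hk, yonedaEquiv_symm_comp] at this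
      exact (yonedaEquiv _ _).symm.injective this
    ext Y y
    let e : op ((equivSmallModel C).inverse.obj ((equivSmallModel C).functor.obj Y.unop)) ≅ Y :=
      ((equivSmallModel C).unitIso.app Y.unop).op
    have hy : y = N.obj.map e.hom (N.obj.map e.inv y) := by
      rw [← ConcreteCategory.comp_apply, ← Functor.map_comp]; simp
    change f.hom.app Y y = g.hom.app Y y
    generalize hz : N.obj.map e.inv y = z at hy
    rw [hy, NatTrans.naturality_apply, NatTrans.naturality_apply, key]

instance (N : CatMod.{w} C) : Projective (cover N) where
  factors {E X} f e _ := by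
    refine ⟨Sigma.desc fun i => Projective.factorThru (P := coverFamily N i)
      (Sigma.ι (coverFamily N) i ≫ f) e, ?_⟩
    refine Sigma.hom_ext _ _ fun i => ?_
    rw [Sigma.ι_desc_assoc, Projective.factorThru_comp]

instance : EnoughProjectives (CatMod.{w} C) where
  presentation N := ⟨{ p := cover N, f := coverπ N }⟩

instance : HasExt.{w} (CatMod.{w} C) := hasExt_of_enoughProjectives _

end Cover

section Tensor

variable {A : Type u} [Category.{v} A] [Preadditive A] [EssentiallySmall.{w} A]
variable {B : Type u'} [Category.{v'} B] [Preadditive B] [LocallySmall.{w} B]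
  [HasColimitsOfSize.{w, w} B]

/-- `J X` corepresents `M ↦ Hom(C(-, X), Hom(J -, M))`. -/
noncomputable def reprCorepresentable (J : A ⥤ B) [J.Additive] (X : A) :
    (homFunctor.{w} J ⋙ coyoneda.obj (op (repr.{w} X))).CorepresentableBy (J.obj X) where
  homEquiv {M} := (homElem J M X).trans (yonedaEquiv X _).symm
  homEquiv_comp {M N} g f := by
    change (yonedaEquiv X _).symm _ = (yonedaEquiv X _).symm _ ≫ (homFunctor J).map g
    rw [yonedaEquiv_symm_comp, homFunctor_map_homElem]

lemma leftAdjointObjIsDefined_cover (J : A ⥤ B) [J.Additive] (N : CatMod.{w} A) :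
    (homFunctor.{w} J).leftAdjointObjIsDefined (cover N) :=
  Functor.leftAdjointObjIsDefined_colimit _ fun i =>
    (reprCorepresentable J ((equivSmallModel A).inverse.obj i.as.1)).isCorepresentable

instance (J : A ⥤ B) [J.Additive] : (homFunctor.{w} J).IsRightAdjoint := by
  apply Functor.isRightAdjoint_of_leftAdjointObjIsDefined_eq_top
  ext N
  simp only [Pi.top_apply, Prop.top_eq_true, iff_true]
  have : HasFiniteColimits B := hasFiniteColimits_of_hasColimitsOfSize.{w, w} B
  have h1 : Epi (coverπ N) := inferInstance
  let K := kernel (coverπ N)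
  have h2 : Epi (coverπ K) := by infer_instance
  exact Functor.leftAdjointObjIsDefined_of_isColimit
    (isCokernelEpiComp (Abelian.epiIsCokernelOfKernel _ (kernelIsKernel (coverπ N)))
      (coverπ (kernel (coverπ N))) (hg := h2) rfl) (by
    rintro (_ | _) <;> exact leftAdjointObjIsDefined_cover J _)

end Tensor
section Ext

variable {A : Type u} [Category.{v} A] [Abelian A] [HasExt.{w} A]

lemma extFunctor_flip_additive (M : A) (n : ℕ) :
    ((Abelian.extFunctor.{w} (C := A) n).flip.obj M).Additive where
  map_add {X Y f g} := by
    rw [Functor.flip_obj_map, Functor.map_add]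
    rfl

end Ext

section Tilting

variable {C : Type u} [Category.{v} C] [Preadditive C] [EssentiallySmall.{w} C]

/-- A module is finitely presented if it is the cokernel of a morphism between finite sums of
representable modules. -/
def IsFinPres (M : CatMod.{w} C) : Prop :=
  ∃ (n m : ℕ) (X : Fin n → C) (Y : Fin m → C)
    (f : (∐ fun i => repr.{w} (X i)) ⟶ ∐ fun j => repr.{w} (Y j))
    (g : (∐ fun j => repr.{w} (Y j)) ⟶ M) (h : f ≫ g = 0),
    (ShortComplex.mk f g h).Exact ∧ Epi g

/-- A full subcategory of `Mod(C)` (given by the property `T` of its objects) is tilting. -/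
structure IsTilting (T : ObjectProperty (CatMod.{w} C)) : Prop where
  isFinPres : ∀ M, T M → IsFinPres M
  projectiveDimension_le_one : ∀ M, T M → HasProjectiveDimensionLE M 1
  ext_eq_zero : ∀ M N, T M → T N → ∀ x : Abelian.Ext.{w} M N 1, x = 0
  exists_resolution : ∀ X : C, ∃ (T₁ T₂ : CatMod.{w} C) (i : repr.{w} X ⟶ T₁) (p : T₁ ⟶ T₂)
    (h : i ≫ p = 0), T T₁ ∧ T T₂ ∧ (ShortComplex.mk i p h).ShortExact

/-- The class of all epimorphic images of direct sums of objects in `T`. -/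
def torsionClass (T : ObjectProperty (CatMod.{w} C)) : ObjectProperty (CatMod.{w} C) :=
  fun M => ∃ (J : Type w) (X : J → CatMod.{w} C) (p : (∐ X) ⟶ M), (∀ j, T (X j)) ∧ Epi p

/-- The class of all modules `N` such that every morphism from an object of the torsion class
to `N` is zero. -/
def torsionFreeClass (T : ObjectProperty (CatMod.{w} C)) : ObjectProperty (CatMod.{w} C) :=
  fun N => ∀ M, torsionClass T M → ∀ f : M ⟶ N, f = 0

variable (T : ObjectProperty (CatMod.{w} C))

/-- The functor `F : M ↦ Hom(-, M)|_T` from `Mod(C)` to `Mod(T)`. -/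
noncomputable abbrev homRestr : CatMod.{w} C ⥤ CatMod.{w} T.FullSubcategory :=
  homFunctor.{w} T.ι

/-- The functor `M ↦ Extⁿ(-, M)|_T` from `Mod(C)` to `Mod(T)`. -/
noncomputable def extRestr (n : ℕ) : CatMod.{w} C ⥤ CatMod.{w} T.FullSubcategory :=
  (additiveFunctor T.FullSubcategoryᵒᵖ AddCommGrpCat.{w}).lift
    ((Abelian.extFunctor.{w} n).flip ⋙
      (Functor.whiskeringLeft T.FullSubcategoryᵒᵖ (CatMod.{w} C)ᵒᵖ AddCommGrpCat.{w}).obj T.ι.op)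
    (fun M => by
      have := extFunctor_flip_additive.{w} M n
      exact inferInstanceAs
        (T.ι.op ⋙ (Abelian.extFunctor.{w} (C := CatMod.{w} C) n).flip.obj M).Additive)

variable [EssentiallySmall.{w} T.FullSubcategory]

/-- The functor `G = - ⊗ T` from `Mod(T)` to `Mod(C)`: the left adjoint of `M ↦ Hom(-, M)|_T`. -/
noncomputable def tensor : CatMod.{w} T.FullSubcategory ⥤ CatMod.{w} C :=
  (homRestr T).leftAdjoint

/-- The adjunction between `- ⊗ T` and `M ↦ Hom(-, M)|_T`. -/
noncomputable def tensorAdj : tensor T ⊣ homRestr T :=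
  Adjunction.ofIsRightAdjoint (homRestr T)

instance : (tensor T).Additive := (tensorAdj T).left_adjoint_additive

/-- The functor `Torₙ(-, T)`, the `n`-th left derived functor of `- ⊗ T`. -/
noncomputable def tor (n : ℕ) : CatMod.{w} T.FullSubcategory ⥤ CatMod.{w} C :=
  (tensor T).leftDerived n

/-- The class of all `T`-modules `N` such that `N ⊗ T = 0`. -/
def classX : ObjectProperty (CatMod.{w} T.FullSubcategory) :=
  fun N => IsZero ((tensor T).obj N)

/-- The class of all `T`-modules `N` such that `Tor₁(N, T) = 0`. -/
def classY : ObjectProperty (CatMod.{w} T.FullSubcategory) :=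
  fun N => IsZero ((tor T 1).obj N)

end Tilting

end CatMod

section General

variable {A : Type u} [Category.{v} A] {B : Type u'} [Category.{v'} B]

/-- The functors `F` and `G` restrict to functors between the full subcategories given by `P` and
`Q`, and these restrictions are mutually quasi-inverse equivalences. -/
def InduceEquivalence (P : ObjectProperty A) (Q : ObjectProperty B) (F : A ⥤ B) (G : B ⥤ A) :
    Prop :=
  ∃ (hF : ∀ X : P.FullSubcategory, Q ((P.ι ⋙ F).obj X))
    (hG : ∀ Y : Q.FullSubcategory, P ((Q.ι ⋙ G).obj Y)),
    Nonempty (𝟭 P.FullSubcategory ≅ Q.lift (P.ι ⋙ F) hF ⋙ P.lift (Q.ι ⋙ G) hG) ∧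
    Nonempty (P.lift (Q.ι ⋙ G) hG ⋙ Q.lift (P.ι ⋙ F) hF ≅ 𝟭 Q.FullSubcategory)

/-- The pair `(P, Q)` is a torsion theory in an abelian category: there are no nonzero morphisms
from `P` to `Q`, both classes are maximal with this property, and every object is an extension of
an object in `Q` by an object in `P`. -/
structure IsTorsionTheory [Abelian A] (P Q : ObjectProperty A) : Prop where
  hom_eq_zero : ∀ X Y, P X → Q Y → ∀ f : X ⟶ Y, f = 0
  left_maximal : ∀ X, (∀ Y, Q Y → ∀ f : X ⟶ Y, f = 0) → P X
  right_maximal : ∀ Y, (∀ X, P X → ∀ f : X ⟶ Y, f = 0) → Q Y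
  exists_shortExact : ∀ N : A, ∃ (X Y : A) (i : X ⟶ N) (p : N ⟶ Y) (h : i ≫ p = 0),
    P X ∧ Q Y ∧ (ShortComplex.mk i p h).ShortExact

end General

/-! Everything is extracted from the adjunction between $G=-\otimes\mathcal T$ and
$F=\mathrm{Hom}(-,\cdot)|_{\mathcal T}$. Three facts carry the argument. First, $\mathscr T$
consists exactly of the modules $M$ with $\mathrm{Ext}^1(T,M)=0$ for all $T\in\mathcal T$
(`IsTilting.torsionClass_iff`). Second, objects of $\mathcal T$ are finitely generated, so $F$ turns
sums of objects of $\mathcal T$ into sums of representables, and the unit is invertible on such sums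
(`IsTilting.isIso_unit_cover`). Third, $\mathrm{Tor}_1(N,\mathcal T)=0$ for every submodule $N$ of
some $F(M)$ (`IsTilting.mono_tensor_map`, `IsTilting.isZero_tor_of_mono`); this is a chase along the
sequences $0\to\mathcal C(-,X)\to T_1\to T_2\to0$.

It follows that the unit is always epi and is invertible on $\mathscr Y$, while for $M\in\mathscr T$
the kernel of the counit is both torsion and torsion-free, hence zero. This is (i), and $0\to\ker\to
N\to FG(N)\to0$ is the torsion sequence of $N$.

For (ii), a torsion-free $M$ embeds in some $E\in\mathscr T$ with quotient a sum $Q$ of objects of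
$\mathcal T$. Then $0\to F(E)\to F(Q)\to F'(M)\to0$ is exact with $F(Q)$ projective, so $G'F'(M)$ is
the kernel of $GF(E)\to GF(Q)$, that is, of $E\to Q$, which is $M$. Dually, if $N\otimes\mathcal
T=0$ and $0\to K\to P\to N\to0$ is the canonical cover, then $0\to G'(N)\to G(K)\to G(P)\to0$ is
exact, and $F'G'(N)$ is the cokernel of $FG(K)\to FG(P)$, that is, of $K\to P$, which is $N$. -/

namespace CategoryTheory.ShortComplex

/-! ### Lifting and homotopy for morphisms of short exact sequences. -/

variable {A : Type u} [Category.{v} A] [Abelian A]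

lemma ShortExact.exists_hom_of_projective {S S' : ShortComplex A} [Projective S.X₂]
    (hS' : S'.ShortExact) (f : S.X₃ ⟶ S'.X₃) : ∃ φ : S ⟶ S', φ.τ₃ = f := by
  have := hS'.mono_f
  have := hS'.epi_g
  have w : (S.f ≫ Projective.factorThru (S.g ≫ f) S'.g) ≫ S'.g = 0 := by simp
  exact ⟨{ τ₁ := hS'.exact.lift _ w
           τ₂ := Projective.factorThru (S.g ≫ f) S'.g
           τ₃ := f }, rfl⟩

/-- The difference of the middle components dies in `S'.X₃`, so it factors through `S'.X₁`. This is
what makes the connecting maps below independent of choices. -/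
lemma ShortExact.exists_homotopy {S S' : ShortComplex A} (hS' : S'.ShortExact) (φ ψ : S ⟶ S')
    (h : φ.τ₃ = ψ.τ₃) : ∃ s : S.X₂ ⟶ S'.X₁, φ.τ₁ = ψ.τ₁ + S.f ≫ s := by
  have := hS'.mono_f
  have w : (φ.τ₂ - ψ.τ₂) ≫ S'.g = 0 := by
    rw [Preadditive.sub_comp, φ.comm₂₃, ψ.comm₂₃, h, sub_self]
  refine ⟨hS'.exact.lift _ w, ?_⟩
  rw [← cancel_mono S'.f, Preadditive.add_comp, Category.assoc, hS'.exact.lift_f,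
    Preadditive.comp_sub, φ.comm₁₂, ψ.comm₁₂]
  abel

end CategoryTheory.ShortComplex

/-! ### First homology as a kernel on a cokernel of `d 2 1`. -/

namespace ChainComplex

variable {B : Type u'} [Category.{v'} B] [Abelian B] (L : ChainComplex B ℕ)

/-- The map out of the first homology induced by a map which vanishes on boundaries. -/
noncomputable def homologyOneDesc {Z : B} (e : L.X 1 ⟶ Z) (he : L.d 2 1 ≫ e = 0) :
    L.homology 1 ⟶ Z :=
  L.homologyι 1 ≫ L.descOpcycles e 2 (by simp) he

lemma homologyOneDesc_comp {Z P : B} (e : L.X 1 ⟶ Z) (he : L.d 2 1 ≫ e = 0) (f : Z ⟶ P)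
    (j : L.X 0 ⟶ P) (h : e ≫ f = L.d 1 0 ≫ j) : homologyOneDesc L e he ≫ f = 0 := by
  have : L.descOpcycles e 2 (by simp) he ≫ f = L.fromOpcycles 1 0 ≫ j := by
    rw [← cancel_epi (L.pOpcycles 1), HomologicalComplex.p_descOpcycles_assoc, h,
      HomologicalComplex.p_fromOpcycles_assoc]
  rw [homologyOneDesc, Category.assoc, this, HomologicalComplex.homologyι_comp_fromOpcycles_assoc,
    zero_comp]

lemma isIso_descOpcycles_of_isColimit {Z : B} (e : L.X 1 ⟶ Z) (he : L.d 2 1 ≫ e = 0)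
    (h : IsColimit (CokernelCofork.ofπ e he)) : IsIso (L.descOpcycles e 2 (by simp) he) := by
  let h₂ := L.opcyclesIsCokernel 2 1 (by simp)
  have e : L.descOpcycles e 2 (by simp) he = (h₂.coconePointUniqueUpToIso h).hom := by
    rw [← cancel_epi (L.pOpcycles 1), HomologicalComplex.p_descOpcycles]
    exact (h₂.comp_coconePointUniqueUpToIso_hom h WalkingParallelPair.one).symm
  rw [e]
  exact Iso.isIso_hom _

lemma mono_homologyOneDesc {Z : B} (e : L.X 1 ⟶ Z) (he : L.d 2 1 ≫ e = 0)
    (h : IsColimit (CokernelCofork.ofπ e he)) : Mono (homologyOneDesc L e he) := by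
  have := isIso_descOpcycles_of_isColimit L e he h
  exact mono_comp _ _

/-- Since `e` is a cokernel of `d 2 1`, `Z` is the object of opcycles, and the first homology is the
kernel of opcycles → `L.X 0`; the mono `j` does not change this kernel. -/
lemma exists_lift_homologyOneDesc {Z P : B} (e : L.X 1 ⟶ Z) (he : L.d 2 1 ≫ e = 0)
    (h : IsColimit (CokernelCofork.ofπ e he)) (f : Z ⟶ P) (j : L.X 0 ⟶ P) [Mono j]
    (w : e ≫ f = L.d 1 0 ≫ j) {Y : B} (z : Y ⟶ Z) (hz : z ≫ f = 0) :
    ∃ l, l ≫ homologyOneDesc L e he = z := by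
  have := isIso_descOpcycles_of_isColimit L e he h
  have h₁ : L.descOpcycles e 2 (by simp) he ≫ f = L.fromOpcycles 1 0 ≫ j := by
    rw [← cancel_epi (L.pOpcycles 1), HomologicalComplex.p_descOpcycles_assoc, w,
      HomologicalComplex.p_fromOpcycles_assoc]
  have h₂ : (z ≫ CategoryTheory.inv (L.descOpcycles e 2 _ he)) ≫ L.fromOpcycles 1 0 = 0 := by
    rw [← cancel_mono j, Category.assoc, Category.assoc, ← h₁, IsIso.inv_hom_id_assoc, hz,
      zero_comp]
  obtain ⟨l, hl⟩ := KernelFork.IsLimit.lift' (L.homologyIsKernel 1 0 (by simp)) _ h₂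
  refine ⟨l, ?_⟩
  change l ≫ L.homologyι 1 = _ at hl
  rw [homologyOneDesc, reassoc_of% hl, IsIso.inv_hom_id, Category.comp_id]

lemma homologyMap_homologyOneDesc {L L' : ChainComplex B ℕ} (φ : L ⟶ L') {Z Z' : B}
    (e : L.X 1 ⟶ Z) (he : L.d 2 1 ≫ e = 0) (e' : L'.X 1 ⟶ Z') (he' : L'.d 2 1 ≫ e' = 0)
    (k : Z ⟶ Z') (h : e ≫ k = φ.f 1 ≫ e') :
    HomologicalComplex.homologyMap φ 1 ≫ homologyOneDesc L' e' he' =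
      homologyOneDesc L e he ≫ k := by
  have h₁ : L.descOpcycles e 2 (by simp) he ≫ k =
      HomologicalComplex.opcyclesMap φ 1 ≫ L'.descOpcycles e' 2 (by simp) he' := by
    rw [← cancel_epi (L.pOpcycles 1), HomologicalComplex.p_descOpcycles_assoc, h,
      HomologicalComplex.p_opcyclesMap_assoc, HomologicalComplex.p_descOpcycles]
  rw [homologyOneDesc, homologyOneDesc, Category.assoc, h₁,
    HomologicalComplex.homologyι_naturality_assoc]

end ChainComplex

/-! ### The first left derived functor of a right exact functor, through syzygies. -/

namespace CategoryTheory.Functor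

variable {A : Type u} [Category.{v} A] [Abelian A]
variable {B : Type u'} [Category.{v'} B] [Abelian B]
variable (G : A ⥤ B) [G.Additive]

section

/-- The two maps differ by `S.f ≫ s`, and `z` kills the image of `S.f`. -/
lemma comp_map_eq_of_τ₃_eq {S S' : ShortComplex A} (hS' : S'.ShortExact) (φ ψ : S ⟶ S')
    (h : φ.τ₃ = ψ.τ₃) {Z : B} (z : Z ⟶ G.obj S.X₁) (hz : z ≫ G.map S.f = 0) :
    z ≫ G.map φ.τ₁ = z ≫ G.map ψ.τ₁ := by
  obtain ⟨s, hs⟩ := hS'.exists_homotopy φ ψ h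
  rw [hs, G.map_add, G.map_comp, Preadditive.comp_add, reassoc_of% hz, zero_comp, add_zero]

end

variable [PreservesFiniteColimits G] [HasProjectiveResolutions A]



/-- The augmentation of the chosen projective resolution. -/
noncomputable def resolutionπ (N : A) : (projectiveResolution N).complex.X 0 ⟶ N :=
  (projectiveResolution N).π.f 0

/-- The short complex formed by the first syzygy, the projective cover and the object, for the
chosen projective resolution. -/
noncomputable abbrev syzygyComplex (N : A) : ShortComplex A :=
  ShortComplex.mk (X₃ := N) (kernel.ι (resolutionπ N)) (resolutionπ N) (kernel.condition _)

lemma syzygyComplex_shortExact (N : A) : (syzygyComplex N).ShortExact where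
  exact := ShortComplex.exact_kernel _
  mono_f := inferInstanceAs (Mono (kernel.ι (resolutionπ N)))
  epi_g := inferInstanceAs (Epi ((projectiveResolution N).π.f 0))

instance (N : A) : Projective (syzygyComplex N).X₂ :=
  (projectiveResolution N).projective 0

instance (N : A) : Mono (syzygyComplex N).f := (syzygyComplex_shortExact N).mono_f

/-- The map from the degree one part of the chosen projective resolution to the first syzygy. -/
noncomputable def toSyzygy (N : A) : (projectiveResolution N).complex.X 1 ⟶ (syzygyComplex N).X₁ :=
  kernel.lift _ ((projectiveResolution N).complex.d 1 0)
    (projectiveResolution N).complex_d_comp_π_f_zero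

/-- The identification of the middle term of the syzygy complex. -/
noncomputable def toSyzygyMid (N : A) :
    (projectiveResolution N).complex.X 0 ≅ (syzygyComplex N).X₂ :=
  Iso.refl _

lemma toSyzygy_f (N : A) : toSyzygy N ≫ (syzygyComplex N).f =
    (projectiveResolution N).complex.d 1 0 ≫ (toSyzygyMid N).hom :=
  (kernel.lift_ι _ _ _).trans (Category.comp_id _).symm

lemma d_toSyzygy (N : A) : (projectiveResolution N).complex.d 2 1 ≫ toSyzygy N = 0 := by
  rw [← cancel_mono (syzygyComplex N).f, Category.assoc, toSyzygy_f, zero_comp,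
    HomologicalComplex.d_comp_d_assoc, zero_comp]

instance (N : A) : Epi (toSyzygy N) :=
  ((projectiveResolution N).exact₀).epi_kernelLift

/-- Replacing the target of `d 1 0` by a subobject through which it factors does not affect
exactness. -/
lemma toSyzygy_exact (N : A) : (ShortComplex.mk _ _ (d_toSyzygy N)).Exact := by
  let φ : ShortComplex.mk _ _ (d_toSyzygy N) ⟶ ShortComplex.mk _ _
      ((projectiveResolution N).complex.d_comp_d 2 1 0) :=
    { τ₁ := 𝟙 _
      τ₂ := 𝟙 _
      τ₃ := (syzygyComplex N).f ≫ (toSyzygyMid N).inv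
      comm₁₂ := by simp
      comm₂₃ := by
        simp only [Category.id_comp]
        rw [← Category.assoc, toSyzygy_f, Category.assoc, Iso.hom_inv_id, Category.comp_id] }
  have : Epi φ.τ₁ := inferInstanceAs (Epi (𝟙 _))
  have : IsIso φ.τ₂ := inferInstanceAs (IsIso (𝟙 _))
  have : Mono φ.τ₃ := inferInstanceAs (Mono ((syzygyComplex N).f ≫ (toSyzygyMid N).inv))
  exact (ShortComplex.exact_iff_of_epi_of_isIso_of_mono φ).2
    ((projectiveResolution N).exact_succ 0)

/-- The image under `G` of the chosen projective resolution. -/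
noncomputable abbrev mapResolution (N : A) : ChainComplex B ℕ :=
  (G.mapHomologicalComplex _).obj (projectiveResolution N).complex

/-- The image of `toSyzygy`. -/
noncomputable def mapToSyzygy (N : A) : (mapResolution G N).X 1 ⟶ G.obj (syzygyComplex N).X₁ :=
  G.map (toSyzygy N)

/-- The image of `toSyzygyMid`. -/
noncomputable def mapToSyzygyMid (N : A) : (mapResolution G N).X 0 ≅ G.obj (syzygyComplex N).X₂ :=
  G.mapIso (toSyzygyMid N)

/-- The first left derived functor as homology of the image of the chosen resolution. -/
noncomputable def leftDerivedOneIso (N : A) :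
    (G.leftDerived 1).obj N ≅ (mapResolution G N).homology 1 :=
  (projectiveResolution N).isoLeftDerivedObj G 1

omit [PreservesFiniteColimits G] in
lemma d_mapToSyzygy (N : A) : (mapResolution G N).d 2 1 ≫ mapToSyzygy G N = 0 :=
  (G.map_comp _ _).symm.trans ((congrArg _ (d_toSyzygy N)).trans (G.map_zero _ _))

/-- The canonical map from the first left derived functor to the image of the syzygy. -/
noncomputable def leftDerivedOneSyzygyι (N : A) :
    (G.leftDerived 1).obj N ⟶ G.obj (syzygyComplex N).X₁ :=
  (leftDerivedOneIso G N).hom ≫ (mapResolution G N).homologyOneDesc _ (d_mapToSyzygy G N)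

/-- The image of the syzygy is a cokernel. -/
noncomputable def isColimitMapSyzygy (N : A) :
    IsColimit (CokernelCofork.ofπ (f := (mapResolution G N).d 2 1) _ (d_mapToSyzygy G N)) :=
  CokernelCofork.mapIsColimit _ (toSyzygy_exact N).gIsCokernel G

instance (N : A) : Mono (leftDerivedOneSyzygyι G N) := by
  have := ChainComplex.mono_homologyOneDesc (mapResolution G N) _ _ (isColimitMapSyzygy G N)
  exact mono_comp _ _

omit [PreservesFiniteColimits G] in
lemma mapToSyzygy_f (N : A) : mapToSyzygy G N ≫ G.map (syzygyComplex N).f =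
      (mapResolution G N).d 1 0 ≫ (mapToSyzygyMid G N).hom :=
  (G.map_comp _ _).symm.trans ((congrArg _ (toSyzygy_f N)).trans (G.map_comp _ _))

omit [PreservesFiniteColimits G] in
lemma leftDerivedOneSyzygyι_map (N : A) :
    leftDerivedOneSyzygyι G N ≫ G.map (syzygyComplex N).f = 0 := by
  rw [leftDerivedOneSyzygyι, Category.assoc,
    ChainComplex.homologyOneDesc_comp _ _ _ _ _ (mapToSyzygy_f G N), comp_zero]

lemma exists_lift_leftDerivedOneSyzygyι (N : A) {Z : B} (z : Z ⟶ G.obj (syzygyComplex N).X₁)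
    (hz : z ≫ G.map (syzygyComplex N).f = 0) :
    ∃ l, l ≫ leftDerivedOneSyzygyι G N = z := by
  obtain ⟨l, hl⟩ := ChainComplex.exists_lift_homologyOneDesc _ _ _ (isColimitMapSyzygy G N) _ _
    (mapToSyzygy_f G N) z hz
  refine ⟨l ≫ (leftDerivedOneIso G N).inv, ?_⟩
  rw [leftDerivedOneSyzygyι, Category.assoc, Iso.inv_hom_id_assoc, hl]

omit [PreservesFiniteColimits G] in
lemma exists_syzygyComplex_map {N N' : A} (f : N ⟶ N') :
    ∃ φ : syzygyComplex N ⟶ syzygyComplex N', φ.τ₃ = f ∧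
      (G.leftDerived 1).map f ≫ leftDerivedOneSyzygyι G N' =
        leftDerivedOneSyzygyι G N ≫ G.map φ.τ₁ := by
  let ψ := ProjectiveResolution.lift f (projectiveResolution N) (projectiveResolution N')
  have hψ : ψ.f 0 ≫ (projectiveResolution N').π.f 0 = (projectiveResolution N).π.f 0 ≫ f :=
    ProjectiveResolution.lift_commutes_zero _ _ _
  let φ : syzygyComplex N ⟶ syzygyComplex N' :=
    { τ₁ := kernel.map _ _ (ψ.f 0) f hψ.symm
      τ₂ := ψ.f 0
      τ₃ := f
      comm₁₂ := kernel.lift_ι _ _ _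
      comm₂₃ := hψ }
  have h₁ : toSyzygy N ≫ φ.τ₁ = ψ.f 1 ≫ toSyzygy N' := by
    rw [← cancel_mono (syzygyComplex N').f, Category.assoc, Category.assoc, φ.comm₁₂,
      toSyzygy_f]
    exact (kernel.lift_ι_assoc _ _ _ _).trans ((ψ.comm 1 0).symm.trans
      (congrArg (ψ.f 1 ≫ ·) (Category.comp_id _).symm))
  refine ⟨φ, rfl, ?_⟩
  have h₂ := ChainComplex.homologyMap_homologyOneDesc ((G.mapHomologicalComplex _).map ψ) _
    (d_mapToSyzygy G N) _ (d_mapToSyzygy G N') (G.map φ.τ₁)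
    ((G.map_comp _ _).symm.trans ((congrArg _ h₁).trans (G.map_comp _ _)))
  have h₃ : (G.leftDerived 1).map f ≫ (leftDerivedOneIso G N').hom = (leftDerivedOneIso G N).hom ≫
      HomologicalComplex.homologyMap ((G.mapHomologicalComplex _).map ψ) 1 :=
    ProjectiveResolution.isoLeftDerivedObj_hom_naturality f _ _ ψ hψ G 1
  rw [leftDerivedOneSyzygyι, leftDerivedOneSyzygyι, reassoc_of% h₃, h₂, Category.assoc]

variable {S : ShortComplex A} (hS : S.ShortExact)

/-- The morphism from the syzygy complex of the third object of a short exact sequence. -/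
noncomputable def ofSyzygyComplex : syzygyComplex S.X₃ ⟶ S :=
  (hS.exists_hom_of_projective (S := syzygyComplex S.X₃) (𝟙 S.X₃)).choose

@[simp]
lemma ofSyzygyComplex_τ₃ : (ofSyzygyComplex hS).τ₃ = 𝟙 S.X₃ :=
  (hS.exists_hom_of_projective (S := syzygyComplex S.X₃) (𝟙 S.X₃)).choose_spec

/-- The connecting morphism of the left derived functors of a right exact functor in degree one. -/
noncomputable def leftDerivedOneι : (G.leftDerived 1).obj S.X₃ ⟶ G.obj S.X₁ :=
  leftDerivedOneSyzygyι G S.X₃ ≫ G.map (ofSyzygyComplex hS).τ₁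

omit [PreservesFiniteColimits G] in
lemma leftDerivedOneι_map : leftDerivedOneι G hS ≫ G.map S.f = 0 := by
  rw [leftDerivedOneι, Category.assoc, ← G.map_comp, (ofSyzygyComplex hS).comm₁₂, G.map_comp,
    reassoc_of% leftDerivedOneSyzygyι_map, zero_comp]

omit [PreservesFiniteColimits G] in
lemma leftDerivedOneι_naturality {S' : ShortComplex A} (hS' : S'.ShortExact) (φ : S ⟶ S') :
    (G.leftDerived 1).map φ.τ₃ ≫ leftDerivedOneι G hS' = leftDerivedOneι G hS ≫ G.map φ.τ₁ := by
  obtain ⟨ψ, hψ, h⟩ := exists_syzygyComplex_map G φ.τ₃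
  rw [leftDerivedOneι, leftDerivedOneι, reassoc_of% h, Category.assoc, ← G.map_comp, ← G.map_comp]
  exact comp_map_eq_of_τ₃_eq G hS' (ψ ≫ ofSyzygyComplex hS') (ofSyzygyComplex hS ≫ φ)
    (by simp [hψ]) _ (leftDerivedOneSyzygyι_map G _)

section

variable [Projective S.X₂]

/-- The morphism to the syzygy complex of the third object of a short exact sequence. -/
lemma exists_toSyzygyComplex : ∃ φ : S ⟶ syzygyComplex S.X₃, φ.τ₃ = 𝟙 S.X₃ :=
  (syzygyComplex_shortExact S.X₃).exists_hom_of_projective (𝟙 S.X₃)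

omit [PreservesFiniteColimits G] in
lemma leftDerivedOneι_syzygyComplex (N : A) :
    leftDerivedOneι G (syzygyComplex_shortExact N) = leftDerivedOneSyzygyι G N := by
  have := comp_map_eq_of_τ₃_eq G (syzygyComplex_shortExact N)
    (ofSyzygyComplex (syzygyComplex_shortExact N)) (𝟙 _) (by simp) _
    (leftDerivedOneSyzygyι_map G _)
  rw [ShortComplex.id_τ₁, G.map_id, Category.comp_id] at this
  exact this

/-- With `S.X₂` projective there is also a comparison from `S` back to the syzygy sequence; followed
by it, the map becomes the known mono `leftDerivedOneSyzygyι`. -/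
lemma mono_leftDerivedOneι : Mono (leftDerivedOneι G hS) := by
  obtain ⟨φ, hφ⟩ := exists_toSyzygyComplex (S := S)
  have := leftDerivedOneι_naturality G hS (syzygyComplex_shortExact S.X₃) φ
  rw [hφ, leftDerivedOneι_syzygyComplex, G.leftDerived 1 |>.map_id, Category.id_comp] at this
  exact mono_of_mono_fac this.symm

lemma exists_lift_leftDerivedOneι {Z : B} (z : Z ⟶ G.obj S.X₁) (hz : z ≫ G.map S.f = 0) :
    ∃ l, l ≫ leftDerivedOneι G hS = z := by
  obtain ⟨φ, hφ⟩ := exists_toSyzygyComplex (S := S)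
  obtain ⟨l, hl⟩ := exists_lift_leftDerivedOneSyzygyι G S.X₃ (z ≫ G.map φ.τ₁) (by
    rw [Category.assoc, ← G.map_comp, φ.comm₁₂, G.map_comp, reassoc_of% hz, zero_comp])
  refine ⟨l, ?_⟩
  rw [leftDerivedOneι, reassoc_of% hl, ← G.map_comp]
  have := comp_map_eq_of_τ₃_eq G hS (φ ≫ ofSyzygyComplex hS) (𝟙 _) (by simp [hφ]) z hz
  rwa [ShortComplex.id_τ₁, G.map_id, Category.comp_id] at this

/-- The first left derived functor as a kernel. -/
lemma leftDerivedOne_isZero_iff (hS : S.ShortExact) : IsZero ((G.leftDerived 1).obj S.X₃) ↔ Mono (G.map S.f) := by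
  refine ⟨fun h => Preadditive.mono_of_cancel_zero _ fun z hz => ?_, fun h => ?_⟩
  · obtain ⟨l, rfl⟩ := exists_lift_leftDerivedOneι G hS z hz
    rw [h.eq_of_tgt l 0, zero_comp]
  · have := mono_leftDerivedOneι G hS
    rw [IsZero.iff_id_eq_zero, ← cancel_mono (leftDerivedOneι G hS), ← cancel_mono (G.map S.f)]
    simp [leftDerivedOneι_map]

end

/-- Unlike in the previous criterion, `S.X₂` need not be projective. A projective presentation $0\to
R_1\to R_2\to S_3\to0$ yields an exact sequence $0\to R_1\to S_1\oplus R_2\to S_2\to0$, to which the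
right exact `G` is applied. -/
lemma mono_map_of_isZero_leftDerivedOne (hS : S.ShortExact)
    (h : IsZero ((G.leftDerived 1).obj S.X₃)) : Mono (G.map S.f) := by
  have := hS.mono_f
  let R := syzygyComplex S.X₃
  have : Mono (G.map R.f) :=
    (leftDerivedOne_isZero_iff G (syzygyComplex_shortExact S.X₃)).1 h
  let φ : R ⟶ S := ofSyzygyComplex hS
  have hφ : φ.τ₂ ≫ S.g = R.g := by
    rw [φ.comm₂₃, ofSyzygyComplex_τ₃, Category.comp_id]
  have w : biprod.lift (-φ.τ₁) R.f ≫ biprod.desc S.f φ.τ₂ = 0 := by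
    rw [biprod.lift_desc, Preadditive.neg_comp, φ.comm₁₂, neg_add_cancel]
  have hepi : Epi (biprod.desc S.f φ.τ₂) := Preadditive.epi_of_cancel_zero _ fun u hu => by
    have h₁ : S.f ≫ u = 0 := by rw [← biprod.inl_desc_assoc S.f φ.τ₂, hu, comp_zero]
    have h₂ : φ.τ₂ ≫ u = 0 := by rw [← biprod.inr_desc_assoc S.f φ.τ₂, hu, comp_zero]
    have := hS.epi_g
    have := (syzygyComplex_shortExact S.X₃).epi_g
    obtain ⟨v, rfl⟩ : ∃ v, S.g ≫ v = u := ⟨hS.exact.desc u h₁, hS.exact.g_desc u h₁⟩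
    rw [reassoc_of% hφ, ← comp_zero (f := R.g), cancel_epi] at h₂
    rw [h₂, comp_zero]
  have hmono : Mono (biprod.lift (-φ.τ₁) R.f) :=
    mono_of_mono_fac (biprod.lift_snd (-φ.τ₁) R.f)
  have hex : (ShortComplex.mk _ _ w).Exact := by
    refine ShortComplex.exact_of_f_is_kernel _ (KernelFork.IsLimit.ofι' _ _ fun {Z} k hk => ?_)
    change Z ⟶ S.X₁ ⊞ R.X₂ at k
    have hk' : k ≫ biprod.fst ≫ S.f + k ≫ biprod.snd ≫ φ.τ₂ = 0 := by
      rw [← Preadditive.comp_add, ← biprod.desc_eq]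
      exact hk
    have h₁ : (k ≫ biprod.snd) ≫ R.g = 0 := by
      rw [← hφ, ← zero_comp (f := S.g), ← hk']
      simp
    refine ⟨(syzygyComplex_shortExact S.X₃).exact.lift _ h₁, ?_⟩
    have h₂ := (syzygyComplex_shortExact S.X₃).exact.lift_f _ h₁
    change (syzygyComplex_shortExact S.X₃).exact.lift _ h₁ ≫ biprod.lift (-φ.τ₁) R.f = k
    apply biprod.hom_ext
    · rw [← cancel_mono S.f, Category.assoc, Category.assoc, biprod.lift_fst_assoc, Preadditive.neg_comp,
        φ.comm₁₂, Preadditive.comp_neg, ← Category.assoc, h₂, Category.assoc, Category.assoc]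
      exact (eq_neg_of_add_eq_zero_left hk').symm
    · rw [Category.assoc, biprod.lift_snd]
      exact h₂
  have hG := hex.map_of_epi_of_preservesCokernel G hepi inferInstance
  refine Preadditive.mono_of_cancel_zero _ fun {Z} z hz => ?_
  -- The element $(z,0)$ comes from some $k$ in $G(R_1)$; its second coordinate says that $k$ dies
  -- in $G(R_2)$, so $k=0$ and hence $z=0$.
  obtain ⟨Z', π, hπ, (k : Z' ⟶ G.obj R.X₁), hk⟩ := hG.exact_up_to_refinements (z ≫ G.map biprod.inl) (by
    change (z ≫ G.map biprod.inl) ≫ G.map (biprod.desc S.f φ.τ₂) = 0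
    rw [Category.assoc, ← G.map_comp, biprod.inl_desc, hz])
  change π ≫ z ≫ G.map biprod.inl = k ≫ G.map (biprod.lift (-φ.τ₁) R.f) at hk
  have hk₀ : k = 0 := by
    rw [← cancel_mono (G.map R.f), zero_comp]
    have := congrArg (· ≫ G.map biprod.snd) hk
    simpa only [Category.assoc, ← G.map_comp, biprod.inl_snd, biprod.lift_snd, G.map_zero,
      comp_zero, eq_comm] using this
  rw [hk₀, zero_comp, ← comp_zero (f := π), cancel_epi] at hk
  have := congrArg (· ≫ G.map biprod.fst) hk
  simpa only [Category.assoc, ← G.map_comp, biprod.inl_fst, G.map_id, Category.comp_id,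
    zero_comp] using this

end CategoryTheory.Functor

/-! ### Pointwise criteria for exactness in `Mod(C)`. -/

namespace CatMod

section Evaluation

variable {C : Type u} [Category.{v} C] [Preadditive C]

/-- Evaluation of modules at an object. -/
abbrev ev (X : C) : CatMod.{w} C ⥤ AddCommGrpCat.{w} :=
  AdditiveFunctor.forget _ _ ⋙ (evaluation _ _).obj (op X)

instance (X : C) : (ev.{w} X).Additive where

instance (X : C) : PreservesFiniteLimits (ev.{w} X) := ⟨fun _ _ _ => inferInstance⟩
instance (X : C) : PreservesFiniteColimits (ev.{w} X) := ⟨fun _ _ _ => inferInstance⟩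
instance (X : C) : PreservesColimitsOfSize.{w, w} (ev.{w} X) := ⟨inferInstance⟩

lemma isZero_iff (M : CatMod.{w} C) : IsZero M ↔ ∀ (X : C) (x : M.obj.obj (op X)), x = 0 := by
  refine ⟨fun h X x => ?_, fun h => ?_⟩
  · have : IsZero ((ev X).obj M) := (ev X).map_isZero h
    exact (AddCommGrpCat.subsingleton_of_isZero this).elim _ _
  · rw [IsZero.iff_id_eq_zero]
    ext X x
    exact h X.unop x

/-- Evaluations are exact and jointly detect zero objects, so they jointly detect vanishing
homology. -/
lemma exact_iff (S : ShortComplex (CatMod.{w} C)) :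
    S.Exact ↔ ∀ X : C, (S.map (ev X)).Exact := by
  refine ⟨fun h X => h.map (ev X), fun h => ?_⟩
  rw [ShortComplex.exact_iff_isZero_homology, isZero_iff]
  intro X
  have h₁ : IsZero ((ev X).obj S.homology) :=
    ((ShortComplex.exact_iff_isZero_homology _).1 (h X)).of_iso (S.mapHomologyIso (ev X)).symm
  intro x
  exact (AddCommGrpCat.subsingleton_of_isZero h₁).elim _ _

lemma exact_iff_forall (S : ShortComplex (CatMod.{w} C)) :
    S.Exact ↔ ∀ (X : C) (x : S.X₂.obj.obj (op X)), S.g.hom.app (op X) x = 0 →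
      ∃ y : S.X₁.obj.obj (op X), S.f.hom.app (op X) y = x := by
  rw [exact_iff]
  refine forall_congr' fun X => ?_
  rw [ShortComplex.ab_exact_iff]
  rfl

lemma mono_iff {M N : CatMod.{w} C} (f : M ⟶ N) :
    Mono f ↔ ∀ (X : C) (x : M.obj.obj (op X)), f.hom.app (op X) x = 0 → x = 0 := by
  refine ⟨fun h X x hx => ?_, fun h => Preadditive.mono_of_cancel_zero _ fun {Z} g hg => ?_⟩
  · have : Mono ((ev X).map f) := inferInstance
    exact (AddCommGrpCat.mono_iff_injective _).1 this (hx.trans (map_zero _).symm)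
  · ext X z
    exact h X.unop _ (ConcreteCategory.congr_hom (congrArg (fun k => k.hom.app X) hg) z)

lemma epi_of_surjective {M N : CatMod.{w} C} (f : M ⟶ N)
    (h : ∀ X : C, Function.Surjective (f.hom.app (op X))) : Epi f := by
  refine Preadditive.epi_of_cancel_zero _ fun {Z} g hg => ?_
  ext X z
  obtain ⟨y, rfl⟩ := h X.unop z
  exact ConcreteCategory.congr_hom (congrArg (fun k => k.hom.app X) hg) y

@[simp]
lemma comp_app_apply {M N P : CatMod.{w} C} (f : M ⟶ N) (g : N ⟶ P) (X : Cᵒᵖ) (x : M.obj.obj X) :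
    (f ≫ g).hom.app X x = g.hom.app X (f.hom.app X x) := rfl

@[simp]
lemma zero_app_apply {M N : CatMod.{w} C} (X : Cᵒᵖ) (x : M.obj.obj X) :
    (0 : M ⟶ N).hom.app X x = 0 := rfl

end Evaluation

/-! ### Elements of coproducts have finite support. -/

section Coproduct

open scoped Classical

variable {C : Type u} [Category.{v} C] [Preadditive C] {J : Type w} (M : J → CatMod.{w} C)

/-- The idempotent endomorphism of a coproduct attached to a finite set of indices. -/
noncomputable def finiteTruncation (s : Finset J) : ∐ M ⟶ ∐ M :=
  ∑ j ∈ s, Sigma.π M j ≫ Sigma.ι M j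

lemma ι_finiteTruncation {s : Finset J} {j : J} (hj : j ∈ s) :
    Sigma.ι M j ≫ finiteTruncation M s = Sigma.ι M j := by
  rw [finiteTruncation, Preadditive.comp_sum, Finset.sum_eq_single j]
  · simp
  · intro i _ hi
    rw [Sigma.ι_π_of_ne_assoc _ hi.symm, zero_comp]
  · exact fun h => (h hj).elim

/-- Elements fixed by all large truncations form a subgroup containing the image of every summand.
Quantifying over all `t ⊇ s` is what makes it closed under sums. -/
lemma exists_finiteTruncation_apply (X : C) (z : (∐ M).obj.obj (op X)) :
    ∃ s : Finset J, ∀ t, s ⊆ t → (finiteTruncation M t).hom.app (op X) z = z := by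
  let H : AddSubgroup ((∐ M).obj.obj (op X)) :=
    { carrier := { z | ∃ s : Finset J, ∀ t, s ⊆ t → (finiteTruncation M t).hom.app (op X) z = z }
      zero_mem' := ⟨∅, fun t _ => map_zero _⟩
      add_mem' := by
        rintro a b ⟨s, hs⟩ ⟨s', hs'⟩
        refine ⟨s ∪ s', fun t ht => ?_⟩
        rw [map_add, hs t (Finset.union_subset_left ht), hs' t (Finset.union_subset_right ht)]
      neg_mem' := by
        rintro a ⟨s, hs⟩
        exact ⟨s, fun t ht => by rw [map_neg, hs t ht]⟩ }
  -- Evaluation preserves coproducts, so the quotient map by `H` may be tested on the summands.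
  suffices h : AddCommGrpCat.ofHom (QuotientAddGroup.mk' H) = 0 by
    exact (QuotientAddGroup.eq_zero_iff z).1 (ConcreteCategory.congr_hom h z)
  refine (isColimitOfPreserves (ev X) (colimit.isColimit (Discrete.functor M))).hom_ext
    fun ⟨j⟩ => ?_
  ext x
  refine (QuotientAddGroup.eq_zero_iff _).2 ⟨{j}, fun t ht => ?_⟩
  exact ConcreteCategory.congr_hom (congrArg (fun k => k.hom.app (op X))
    (ι_finiteTruncation M (Finset.singleton_subset_iff.1 ht))) x

lemma eq_zero_of_π_eq_zero (X : C) (z : (∐ M).obj.obj (op X))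
    (h : ∀ j, (Sigma.π M j).hom.app (op X) z = 0) : z = 0 := by
  obtain ⟨s, hs⟩ := exists_finiteTruncation_apply M X z
  rw [← hs s subset_rfl]
  let K : AddSubgroup (∐ M ⟶ ∐ M) :=
    { carrier := { f | f.hom.app (op X) z = 0 }
      zero_mem' := rfl
      add_mem' := by
        intro f g (hf : f.hom.app (op X) z = 0) (hg : g.hom.app (op X) z = 0)
        change f.hom.app (op X) z + g.hom.app (op X) z = 0
        rw [hf, hg, add_zero]
      neg_mem' := by
        intro f (hf : f.hom.app (op X) z = 0)
        change - f.hom.app (op X) z = 0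
        rw [hf, neg_zero] }
  refine K.sum_mem fun j _ => ?_
  change (Sigma.ι M j).hom.app (op X) ((Sigma.π M j).hom.app (op X) z) = 0
  rw [h, map_zero]

variable {M} in
lemma mono_sigmaMap {M' : J → CatMod.{w} C} (f : ∀ j, M j ⟶ M' j) [∀ j, Mono (f j)] :
    Mono (Limits.Sigma.map f) := by
  refine (mono_iff _).2 fun X x hx => eq_zero_of_π_eq_zero M X x fun j => ?_
  refine (mono_iff (f j)).1 inferInstance X _ ?_
  have : Sigma.π M j ≫ f j = Limits.Sigma.map f ≫ Sigma.π M' j := by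
    refine Sigma.hom_ext _ _ fun i => ?_
    rw [Limits.Sigma.ι_map_assoc, Sigma.ι_π, Sigma.ι_π_assoc]
    by_cases h : i = j
    · subst h; simp
    · simp [h]
  rw [← comp_app_apply, this, comp_app_apply, hx, map_zero]

variable [LocallySmall.{w} C]

/-- A morphism out of a finitely generated module is determined by the images of finitely many
generators, each of which has finite support. -/
lemma exists_comp_finiteTruncation {n : ℕ} {X : Fin n → C} {P : CatMod.{w} C}
    (p : (∐ fun i => repr.{w} (X i)) ⟶ P) [Epi p] (f : P ⟶ ∐ M) :
    ∃ s : Finset J, f ≫ finiteTruncation M s = f := by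
  choose s hs using fun i => exists_finiteTruncation_apply M (X i)
    (yonedaEquiv _ _ (Sigma.ι (fun i => repr.{w} (X i)) i ≫ p ≫ f))
  refine ⟨Finset.univ.biUnion s, ?_⟩
  rw [← cancel_epi p]
  refine Sigma.hom_ext _ _ fun i => (yonedaEquiv _ _).injective ?_
  have := hs i _ (Finset.subset_biUnion_of_mem s (Finset.mem_univ i))
  rw [← yonedaEquiv_comp] at this
  simpa only [Category.assoc] using this

end Coproduct

end CatMod

/-! ### Vanishing of `Ext¹` and extension of morphisms. -/

section ExtGeneral

variable {A : Type u} [Category.{v} A] [Abelian A] [HasExt.{w} A]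

open Abelian

lemma CategoryTheory.ShortComplex.ShortExact.exists_extension {S : ShortComplex A}
    (hS : S.ShortExact) {N : A} (h : ∀ x : Ext.{w} S.X₃ N 1, x = 0) (f : S.X₁ ⟶ N) :
    ∃ g : S.X₂ ⟶ N, S.f ≫ g = f := by
  obtain ⟨g, hg⟩ := Ext.contravariant_sequence_exact₁ hS N (Ext.mk₀ f) (add_zero 1) (h _)
  obtain ⟨g, rfl⟩ := (Ext.mk₀_bijective _ _).2 g
  rw [Ext.mk₀_comp_mk₀] at hg
  exact ⟨g, (Ext.mk₀_bijective _ _).1 hg⟩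

/-- By projectivity of `S.X₂` every class is the extension class pushed out along some `f : S.X₁ ⟶
N`, and this pushout is trivial once `f` extends to `S.X₂`. -/
lemma CategoryTheory.ShortComplex.ShortExact.ext_eq_zero_of_exists_extension {S : ShortComplex A}
    (hS : S.ShortExact) [Projective S.X₂] {N : A}
    (h : ∀ f : S.X₁ ⟶ N, ∃ g : S.X₂ ⟶ N, S.f ≫ g = f) (x : Ext.{w} S.X₃ N 1) : x = 0 := by
  obtain ⟨f, rfl⟩ := Ext.contravariant_sequence_exact₃ hS N x
    (Ext.eq_zero_of_projective _) (add_zero 1)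
  obtain ⟨f, rfl⟩ := (Ext.mk₀_bijective _ _).2 f
  obtain ⟨g, rfl⟩ := h f
  rw [← Ext.mk₀_comp_mk₀, hS.extClass_comp_assoc]

lemma CategoryTheory.ext_eq_zero_of_epi {X N N' : A} [HasProjectiveDimensionLE X 1] (p : N ⟶ N')
    [Epi p] (h : ∀ x : Ext.{w} X N 1, x = 0) (x : Ext.{w} X N' 1) : x = 0 := by
  have hS : (ShortComplex.mk (kernel.ι p) p (kernel.condition p)).ShortExact :=
    { exact := ShortComplex.exact_kernel p }
  obtain ⟨y, rfl⟩ := Ext.covariant_sequence_exact₃ X hS x (n₁ := 2) rfl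
    -- The obstruction lies in `Ext²` with values in the kernel of `p`; projective dimension at most
    -- 1 means less than 2.
    (Ext.eq_zero_of_hasProjectiveDimensionLT _ 2 le_rfl)
  rw [h y, Ext.zero_comp]

end ExtGeneral

/-! ### The torsion class of a tilting subcategory. -/

namespace CatMod

variable {C : Type u} [Category.{v} C] [Preadditive C] [EssentiallySmall.{w} C]

omit [EssentiallySmall.{w} C] in
lemma projective_sigma {J : Type*} (P : J → CatMod.{w} C) [HasCoproduct P]
    [∀ j, Projective (P j)] : Projective (∐ P) where
  factors f e _ :=
    ⟨Sigma.desc fun j => Projective.factorThru (Sigma.ι P j ≫ f) e,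
      Sigma.hom_ext _ _ fun j => by rw [Sigma.ι_desc_assoc, Projective.factorThru_comp]⟩

/-- Both covers are retained: finite generation of the kernel controls `Ext¹` into sums, finite
generation of the module itself controls `Hom` into sums. -/
lemma IsFinPres.exists_shortExact {M : CatMod.{w} C} (hM : IsFinPres M) :
    ∃ (n : ℕ) (X : Fin n → C) (S : ShortComplex (CatMod.{w} C))
      (p : (∐ fun i => repr.{w} (X i)) ⟶ S.X₁),
      S.ShortExact ∧ Epi p ∧ Projective S.X₂ ∧ Nonempty (S.X₃ ≅ M) ∧
      ∃ (m : ℕ) (Y : Fin m → C) (q : (∐ fun i => repr.{w} (Y i)) ⟶ S.X₃), Epi q := by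
  obtain ⟨n, m, X, Y, f, g, w, hex, hg⟩ := hM
  have hP : Projective (∐ fun j => repr.{w} (Y j)) := projective_sigma _
  refine ⟨n, X, ShortComplex.mk (kernel.ι g) g (kernel.condition g), kernel.lift g f w,
    { exact := ShortComplex.exact_kernel g }, hex.epi_kernelLift, hP,
    ⟨Iso.refl _⟩, m, Y, g, hg⟩

section Sigma

variable {J : Type w} {S : J → ShortComplex (CatMod.{w} C)} (hS : ∀ j, (S j).ShortExact)

omit [EssentiallySmall.{w} C] in
lemma sigmaMap_comp_eq_zero :
    Limits.Sigma.map (fun j => (S j).f) ≫ Limits.Sigma.map (fun j => (S j).g) = 0 :=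
  Sigma.hom_ext _ _ fun j => by
    rw [Limits.Sigma.ι_map_assoc, Limits.Sigma.ι_map, (S j).zero_assoc, zero_comp, comp_zero]

include hS in
omit [EssentiallySmall.{w} C] in
lemma sigma_shortExact : (ShortComplex.mk _ _ (sigmaMap_comp_eq_zero (S := S))).ShortExact := by
  have (j : J) : Mono (S j).f := (hS j).mono_f
  have (j : J) : Epi (S j).g := (hS j).epi_g
  refine { exact := ?_, mono_f := mono_sigmaMap fun j => (S j).f, epi_g := inferInstance }
  refine ShortComplex.exact_of_g_is_cokernel _ (CokernelCofork.IsColimit.ofπ' _ _ fun {Z} k hk => ?_)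
  change (∐ fun j => (S j).X₂) ⟶ Z at k
  have hk' (j : J) : (S j).f ≫ Sigma.ι (fun j => (S j).X₂) j ≫ k = 0 := by
    have := congrArg (Sigma.ι (fun j => (S j).X₁) j ≫ ·) hk
    simpa using this
  refine ⟨Sigma.desc fun j => (hS j).exact.desc _ (hk' j), Sigma.hom_ext _ _ fun j => ?_⟩
  rw [Limits.Sigma.ι_map_assoc, Sigma.ι_desc]
  exact (hS j).exact.g_desc _ (hk' j)

/-- The sum of the cover sequences is short exact with projective middle term, and morphisms out of
its kernel extend summand by summand. -/
lemma ext_sigma_left_eq_zero {X : J → CatMod.{w} C} {N : CatMod.{w} C}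
    (h : ∀ j, ∀ x : Abelian.Ext.{w} (X j) N 1, x = 0) (x : Abelian.Ext.{w} (∐ X) N 1) :
    x = 0 := by
  have hS (j : J) : (ShortComplex.mk (kernel.ι (coverπ (X j))) (coverπ (X j))
      (kernel.condition _)).ShortExact := { exact := ShortComplex.exact_kernel _ }
  have := projective_sigma fun j => cover (X j)
  refine (sigma_shortExact hS).ext_eq_zero_of_exists_extension (fun f => ?_) x
  choose g hg using fun j => (hS j).exists_extension (h j)
    (Sigma.ι (fun j => kernel (coverπ (X j))) j ≫ f)
  refine ⟨Sigma.desc g, Sigma.hom_ext _ _ fun j => ?_⟩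
  rw [Limits.Sigma.ι_map_assoc, Sigma.ι_desc, hg]

end Sigma

variable {T : ObjectProperty (CatMod.{w} C)} (hT : IsTilting T)

include hT

/-- The kernel of a finite cover of `M` is finitely generated, so a morphism from it to the sum has
only finitely many relevant components; each of them extends because $\mathrm{Ext}^1(M,X_j)=0$. -/
lemma IsTilting.ext_sigma_eq_zero {M : CatMod.{w} C} (hM : T M) {J : Type w}
    (X : J → CatMod.{w} C) (hX : ∀ j, T (X j)) (x : Abelian.Ext.{w} M (∐ X) 1) : x = 0 := by
  classical
  obtain ⟨n, Y, S, p, hS, hp, hP, ⟨e⟩, -⟩ := (hT.isFinPres M hM).exists_shortExact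
  have key : ∀ y : Abelian.Ext.{w} S.X₃ (∐ X) 1, y = 0 := by
    refine hS.ext_eq_zero_of_exists_extension fun f => ?_
    obtain ⟨s, hs⟩ := exists_comp_finiteTruncation X p f
    have (j : J) : ∃ g : S.X₂ ⟶ X j, S.f ≫ g = f ≫ Sigma.π X j := by
      refine hS.exists_extension (fun y => ?_) _
      have := hT.ext_eq_zero M (X j) hM (hX j)
        ((Abelian.Ext.mk₀ e.inv).comp y (zero_add 1))
      have h₂ := congrArg (fun z => (Abelian.Ext.mk₀ e.hom).comp z (zero_add 1)) this
      simpa using h₂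
    choose g hg using this
    refine ⟨∑ j ∈ s, g j ≫ Sigma.ι X j, ?_⟩
    rw [← hs, finiteTruncation, Preadditive.comp_sum, Preadditive.comp_sum]
    exact Finset.sum_congr rfl fun j _ => by rw [reassoc_of% hg j]
  have h₂ := congrArg (fun z => (Abelian.Ext.mk₀ e.inv).comp z (zero_add 1))
    (key ((Abelian.Ext.mk₀ e.hom).comp x (zero_add 1)))
  simpa using h₂

/-- Forward, the vanishing passes from sums to their quotients by projective dimension at most 1.
Backward, every $\mathcal C(-,X)\to M$ extends along $\mathcal C(-,X)\to T_1$ because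
$\mathrm{Ext}^1(T_2,M)=0$, so the modules $T_1$ jointly cover $M$. -/
lemma IsTilting.torsionClass_iff (M : CatMod.{w} C) :
    torsionClass T M ↔ ∀ N, T N → ∀ x : Abelian.Ext.{w} N M 1, x = 0 := by
  constructor
  · rintro ⟨J, X, p, hX, hp⟩ N hN x
    have := hT.projectiveDimension_le_one N hN
    exact ext_eq_zero_of_epi p (hT.ext_sigma_eq_zero hN X hX) x
  · intro h
    choose T₁ T₂ i p w hT₁ hT₂ hS using hT.exists_resolution
    have (X : C) (f : repr.{w} X ⟶ M) := (hS X).exists_extension (h _ (hT₂ X)) f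
    choose g hg using this
    let J := Σ X : SmallModel.{w} C, M.obj.obj (op ((equivSmallModel C).inverse.obj X))
    have fac : Limits.Sigma.map (fun j : J => i ((equivSmallModel C).inverse.obj j.1)) ≫
        Sigma.desc (fun j : J => g _ ((yonedaEquiv _ M).symm j.2)) = coverπ M := by
      refine Sigma.hom_ext _ _ fun j => ?_
      rw [Limits.Sigma.ι_map_assoc, Sigma.ι_desc]
      have hk : Sigma.ι (coverFamily M) j ≫ coverπ M = (yonedaEquiv _ M).symm j.2 :=
        Sigma.ι_desc _ _
      exact (hg _ _).trans hk.symm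
    exact ⟨J, fun j => T₁ ((equivSmallModel C).inverse.obj j.1), _, fun j => hT₁ _,
      epi_of_epi_fac fac⟩

omit [EssentiallySmall.{w} C] hT in
lemma torsionClass_of_epi {M N : CatMod.{w} C} (h : torsionClass T M) (f : M ⟶ N) [Epi f] :
    torsionClass T N := by
  obtain ⟨J, X, p, hX, hp⟩ := h
  exact ⟨J, X, p ≫ f, hX, epi_comp _ _⟩

omit [EssentiallySmall.{w} C] hT in
lemma torsionClass_sigma {J : Type w} (X : J → CatMod.{w} C) (hX : ∀ j, T (X j)) :
    torsionClass T (∐ X) := ⟨J, X, 𝟙 _, hX, inferInstance⟩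

omit [EssentiallySmall.{w} C] hT in
lemma torsionClass_of_prop {M : CatMod.{w} C} (hM : T M) : torsionClass T M :=
  ⟨PUnit, fun _ => M, Sigma.desc fun _ => 𝟙 _, fun _ => hM,
    epi_of_epi_fac (Sigma.ι_desc (f := fun _ : PUnit => M) (fun _ => 𝟙 M) PUnit.unit)⟩

omit [EssentiallySmall.{w} C] hT in
lemma torsionFreeClass_iff (N : CatMod.{w} C) :
    torsionFreeClass T N ↔ ∀ M, T M → ∀ f : M ⟶ N, f = 0 := by
  refine ⟨fun h M hM f => h M (torsionClass_of_prop hM) f, ?_⟩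
  rintro h M ⟨J, X, p, hX, hp⟩ f
  rw [← cancel_epi p, comp_zero]
  refine Sigma.hom_ext _ _ fun j => ?_
  rw [h _ (hX j) (Sigma.ι X j ≫ p ≫ f), comp_zero]

/-- Sum the tilting resolutions over all elements of `M` and push out along the canonical cover of
`M`. The pushout is a quotient of $\coprod T_1$, hence torsion, and the cokernel $\coprod T_2$ is
unchanged. -/
lemma IsTilting.exists_embedding (M : CatMod.{w} C) :
    ∃ (J : Type w) (X : J → CatMod.{w} C) (E : CatMod.{w} C) (i : M ⟶ E) (p : E ⟶ ∐ X)
      (h : i ≫ p = 0), (∀ j, T (X j)) ∧ torsionClass T E ∧ (ShortComplex.mk i p h).ShortExact := by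
  choose T₁ T₂ i p w hT₁ hT₂ hS using hT.exists_resolution
  let J := Σ X : SmallModel.{w} C, M.obj.obj (op ((equivSmallModel C).inverse.obj X))
  let R : J → C := fun j => (equivSmallModel C).inverse.obj j.1
  have hR := sigma_shortExact fun j => hS (R j)
  let a : cover M ⟶ ∐ (fun j : J => T₁ (R j)) := Limits.Sigma.map (fun j : J => i (R j))
  let b : ∐ (fun j : J => T₁ (R j)) ⟶ ∐ (fun j : J => T₂ (R j)) :=
    Limits.Sigma.map (fun j : J => p (R j))
  have ha : Mono a := hR.mono_f
  have hb : Epi b := hR.epi_g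
  have hab : a ≫ b = 0 :=
    sigmaMap_comp_eq_zero (S := fun j => ShortComplex.mk (i (R j)) (p (R j)) (w (R j)))
  have hu {Z : CatMod.{w} C} (u : ∐ (fun j : J => T₁ (R j)) ⟶ Z) (hu : a ≫ u = 0) :
      ∃ v, b ≫ v = u := ⟨hR.exact.desc u hu, hR.exact.g_desc u hu⟩
  have hw : pushout.inl (coverπ M) a ≫
      pushout.desc (f := coverπ M) (g := a) (0 : M ⟶ _) b (by rw [hab, comp_zero]) = 0 :=
    pushout.inl_desc _ _ _
  have hE : Epi (pushout.desc (f := coverπ M) (g := a) (0 : M ⟶ _) b (by rw [hab, comp_zero])) :=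
    epi_of_epi_fac (pushout.inr_desc _ _ _)
  refine ⟨J, fun j => T₂ (R j), pushout (coverπ M) a, pushout.inl _ _, _, hw, fun j => hT₂ _,
    torsionClass_of_epi (torsionClass_sigma _ fun j => hT₁ (R j)) (pushout.inr _ _), ?_⟩
  refine { exact := ?_, mono_f := inferInstance, epi_g := hE }
  refine ShortComplex.exact_of_g_is_cokernel _ (CokernelCofork.IsColimit.ofπ' _ _ fun {Z} k hk => ?_)
  change pushout (coverπ M) a ⟶ Z at k
  change pushout.inl (coverπ M) a ≫ k = 0 at hk
  have hv := hu (pushout.inr (coverπ M) a ≫ k) (by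
    rw [← pushout.condition_assoc, hk, comp_zero])
  refine ⟨hv.choose, pushout.hom_ext ?_ ?_⟩
  · refine (pushout.inl_desc_assoc _ _ _ _).trans ?_
    rw [zero_comp, hk]
  · exact (pushout.inr_desc_assoc _ _ _ _).trans hv.choose_spec

end CatMod

/-! ### The long exact sequence of `Hom(-, M)` and `Ext¹(-, M)` on `T`. -/

namespace CatMod

variable {C : Type u} [Category.{v} C] [Preadditive C] [EssentiallySmall.{w} C]
variable (T : ObjectProperty (CatMod.{w} C))

/-- Elements of `Ext¹(X, M)`. -/
noncomputable def extElem (M : CatMod.{w} C) (X : T.FullSubcategory) :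
    Abelian.Ext.{w} X.obj M 1 ≃+ ((extRestr.{w} T 1).obj M).obj.obj (op X) :=
  AddEquiv.refl _

lemma map_extElem {M : CatMod.{w} C} {X Y : T.FullSubcategory} (f : X ⟶ Y)
    (x : Abelian.Ext.{w} Y.obj M 1) :
    ((extRestr.{w} T 1).obj M).obj.map f.op (extElem T M Y x) =
      extElem T M X ((Abelian.Ext.mk₀ f.hom).comp x (zero_add 1)) := rfl

lemma extRestr_map_extElem {M N : CatMod.{w} C} (g : M ⟶ N) {X : T.FullSubcategory}
    (x : Abelian.Ext.{w} X.obj M 1) :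
    ((extRestr.{w} T 1).map g).hom.app (op X) (extElem T M X x) =
      extElem T N X (x.comp (Abelian.Ext.mk₀ g) (add_zero 1)) := rfl

lemma isZero_extRestr_iff (M : CatMod.{w} C) :
    IsZero ((extRestr.{w} T 1).obj M) ↔ ∀ N, T N → ∀ x : Abelian.Ext.{w} N M 1, x = 0 := by
  rw [isZero_iff]
  exact ⟨fun h N hN x => h ⟨N, hN⟩ x, fun h X x => h X.obj X.property x⟩

lemma isZero_homRestr_iff (M : CatMod.{w} C) :
    IsZero ((homRestr.{w} T).obj M) ↔ ∀ N, T N → ∀ f : N ⟶ M, f = 0 := by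
  rw [isZero_iff]
  refine ⟨fun h N hN f => (homElem T.ι M ⟨N, hN⟩).injective ?_, fun h X x => ?_⟩
  · rw [h _ (homElem T.ι M ⟨N, hN⟩ f)]
    exact (h _ _).symm
  · obtain ⟨a, rfl⟩ := (homElem T.ι M X).surjective x
    rw [h _ X.property a]
    obtain ⟨b, hb⟩ := (homElem T.ι M X).surjective 0
    rw [← hb, h _ X.property b]

lemma homElem_zero (M : CatMod.{w} C) (X : T.FullSubcategory) :
    homElem T.ι M X 0 = (0 : ((homRestr.{w} T).obj M).obj.obj (op X)) := by
  have := homElem_add.{w} T.ι (0 : X.obj ⟶ M) 0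
  rw [add_zero] at this
  exact left_eq_add.1 this

variable {S : ShortComplex (CatMod.{w} C)} (hS : S.ShortExact)

/-- The connecting morphism `Hom(-, X₃)|_T ⟶ Ext¹(-, X₁)|_T` of a short exact sequence. -/
noncomputable def connecting : (homRestr.{w} T).obj S.X₃ ⟶ (extRestr.{w} T 1).obj S.X₁ :=
  ObjectProperty.homMk
    { app X := AddCommGrpCat.ofHom (AddMonoidHom.mk'
        (fun a => extElem T S.X₁ X.unop ((Abelian.Ext.mk₀
          ((homElem.{w} T.ι S.X₃ X.unop).symm a)).comp hS.extClass (zero_add 1)))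
        (fun a b => by
          obtain ⟨a, rfl⟩ := (homElem.{w} T.ι S.X₃ X.unop).surjective a
          obtain ⟨b, rfl⟩ := (homElem.{w} T.ι S.X₃ X.unop).surjective b
          erw [← homElem_add]
          simp [Abelian.Ext.mk₀_add]
          rfl))
      naturality X Y f := by
        ext a
        obtain ⟨a, rfl⟩ := (homElem.{w} T.ι S.X₃ X.unop).surjective a
        change extElem T S.X₁ Y.unop ((Abelian.Ext.mk₀ ((homElem.{w} T.ι S.X₃ Y.unop).symm
          (((homRestr.{w} T).obj S.X₃).obj.map f.unop.op
            (homElem T.ι S.X₃ X.unop a)))).comp hS.extClass (zero_add 1)) =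
          ((extRestr.{w} T 1).obj S.X₁).obj.map f.unop.op (extElem T S.X₁ X.unop _)
        rw [map_homElem, map_extElem, Equiv.symm_apply_apply, Equiv.symm_apply_apply,
          ← Abelian.Ext.mk₀_comp_mk₀_assoc]
        rfl }

lemma connecting_homElem {X : T.FullSubcategory} (a : X.obj ⟶ S.X₃) :
    (connecting T hS).hom.app (op X) (homElem.{w} T.ι S.X₃ X a) =
      extElem T S.X₁ X ((Abelian.Ext.mk₀ a).comp hS.extClass (zero_add 1)) := by
  change extElem T S.X₁ X ((Abelian.Ext.mk₀ ((homElem.{w} T.ι S.X₃ X).symm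
    (homElem.{w} T.ι S.X₃ X a))).comp hS.extClass (zero_add 1)) = _
  rw [Equiv.symm_apply_apply]

lemma connecting_naturality {S' : ShortComplex (CatMod.{w} C)} (hS' : S'.ShortExact) (φ : S ⟶ S') :
    (homRestr T).map φ.τ₃ ≫ connecting T hS' = connecting T hS ≫ (extRestr T 1).map φ.τ₁ := by
  ext X a
  obtain ⟨a, rfl⟩ := (homElem.{w} T.ι S.X₃ X.unop).surjective a
  change (connecting T hS').hom.app (op X.unop) (((homRestr T).map φ.τ₃).hom.app (op X.unop) _) =
    ((extRestr T 1).map φ.τ₁).hom.app (op X.unop) ((connecting T hS).hom.app (op X.unop) _)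
  rw [homFunctor_map_homElem, connecting_homElem, connecting_homElem, extRestr_map_extElem,
    ← Abelian.Ext.mk₀_comp_mk₀, Abelian.Ext.comp_assoc_of_third_deg_zero,
    hS.extClass_naturality hS' φ, Abelian.Ext.comp_assoc_of_second_deg_zero]

lemma map_comp_connecting : (homRestr T).map S.g ≫ connecting T hS = 0 := by
  ext X a
  obtain ⟨a, rfl⟩ := (homElem.{w} T.ι S.X₂ X.unop).surjective a
  change (connecting T hS).hom.app (op X.unop) (((homRestr T).map S.g).hom.app (op X.unop) _) = 0
  rw [homFunctor_map_homElem, connecting_homElem, ← Abelian.Ext.mk₀_comp_mk₀,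
    Abelian.Ext.comp_assoc_of_second_deg_zero, hS.comp_extClass, Abelian.Ext.comp_zero, map_zero]

lemma connecting_exact :
    (ShortComplex.mk _ _ (map_comp_connecting T hS)).Exact := by
  refine (exact_iff_forall _).2 fun X x hx => ?_
  obtain ⟨a, rfl⟩ := (homElem.{w} T.ι S.X₃ X).surjective x
  have h : (connecting T hS).hom.app (op X) (homElem.{w} T.ι S.X₃ X a) = 0 := hx
  rw [connecting_homElem] at h
  obtain ⟨b, hb⟩ := Abelian.Ext.covariant_sequence_exact₃ X.obj hS (Abelian.Ext.mk₀ a) (zero_add 1)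
    ((extElem T S.X₁ X).map_eq_zero_iff.1 h)
  obtain ⟨b, rfl⟩ := (Abelian.Ext.mk₀_bijective _ _).2 b
  rw [Abelian.Ext.mk₀_comp_mk₀] at hb
  refine ⟨homElem.{w} T.ι S.X₂ X b, ?_⟩
  rw [← (Abelian.Ext.mk₀_bijective _ _).1 hb]
  exact homFunctor_map_homElem _ _ _

lemma epi_connecting (h : IsZero ((extRestr.{w} T 1).obj S.X₂)) : Epi (connecting T hS) := by
  refine epi_of_surjective _ fun X x => ?_
  obtain ⟨x, rfl⟩ := (extElem T S.X₁ X).surjective x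
  obtain ⟨b, rfl⟩ := Abelian.Ext.covariant_sequence_exact₁ X.obj hS x
    ((isZero_extRestr_iff T _).1 h X.obj X.property _) (zero_add 1)
  obtain ⟨b, rfl⟩ := (Abelian.Ext.mk₀_bijective _ _).2 b
  exact ⟨homElem.{w} T.ι S.X₃ X b, connecting_homElem T hS b⟩

lemma epi_homRestr_map (hS : S.ShortExact) (h : IsZero ((extRestr.{w} T 1).obj S.X₁)) :
    Epi ((homRestr T).map S.g) := by
  exact (connecting_exact T hS).epi_f (h.eq_of_tgt _ _)

end CatMod

/-! ### Tensor products and units for sums of representables. -/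

namespace CatMod

variable {C : Type u} [Category.{v} C] [Preadditive C] [EssentiallySmall.{w} C]

variable (T : ObjectProperty (CatMod.{w} C)) [EssentiallySmall.{w} T.FullSubcategory]

/-- The universal map from a representable module to `Hom(-, X)|_T`. -/
noncomputable def reprToHomRestr (X : T.FullSubcategory) :
    repr.{w} X ⟶ (homRestr T).obj X.obj :=
  (reprCorepresentable.{w} T.ι X).homEquiv (𝟙 X.obj)

lemma reprCorepresentable_homEquiv {X : T.FullSubcategory} {M : CatMod.{w} C} (f : X.obj ⟶ M) :
    (reprCorepresentable.{w} T.ι X).homEquiv f = reprToHomRestr T X ≫ (homRestr T).map f :=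
  (congrArg (reprCorepresentable.{w} T.ι X).homEquiv (Category.id_comp f).symm).trans
    ((reprCorepresentable.{w} T.ι X).homEquiv_comp f (𝟙 X.obj))

lemma reprToHomRestr_homElem {X Y : T.FullSubcategory} (a : Y ⟶ X) :
    (reprToHomRestr T X).hom.app (op Y) (homElem.{w} (𝟭 _) X Y a) =
      homElem.{w} T.ι X.obj Y a.hom := by
  change ((homRestr T).obj X.obj).obj.map ((homElem.{w} (𝟭 _) X Y).symm
    (homElem.{w} (𝟭 _) X Y a)).op (homElem.{w} T.ι X.obj X (𝟙 X.obj)) = _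
  rw [Equiv.symm_apply_apply, map_homElem]
  exact congrArg (homElem.{w} T.ι X.obj Y) (Category.comp_id a.hom)

instance (X : T.FullSubcategory) : Mono (reprToHomRestr T X) := by
  refine (mono_iff _).2 fun Y x hx => ?_
  obtain ⟨a, rfl⟩ := (homElem.{w} (𝟭 _) X Y).surjective x
  rw [reprToHomRestr_homElem, ← homElem_zero] at hx
  have ha : a = 0 := by
    ext1
    exact (homElem.{w} T.ι X.obj Y).injective hx
  have := homElem_add.{w} (𝟭 T.FullSubcategory) (0 : Y ⟶ X) 0
  rw [add_zero] at this
  rw [ha]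
  exact left_eq_add.1 this

variable {J : Type w} (X : J → T.FullSubcategory)

/-- The universal map from a sum of representable modules to `Hom(-, ∐ X)|_T`. -/
noncomputable def sigmaReprToHomRestr :
    (∐ fun j => repr.{w} (X j)) ⟶ (homRestr T).obj (∐ fun j => (X j).obj) :=
  Sigma.desc fun j => reprToHomRestr T (X j) ≫ (homRestr T).map (Sigma.ι (fun j => (X j).obj) j)

@[simp]
lemma ι_sigmaReprToHomRestr (j : J) :
    Sigma.ι (fun j => repr.{w} (X j)) j ≫ sigmaReprToHomRestr T X =
      reprToHomRestr T (X j) ≫ (homRestr T).map (Sigma.ι (fun j => (X j).obj) j) :=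
  Sigma.ι_desc _ _

lemma ι_sigmaReprToHomRestr_assoc (j : J) {Z : CatMod.{w} T.FullSubcategory}
    (f : (homRestr T).obj (∐ fun j => (X j).obj) ⟶ Z) :
    Sigma.ι (fun j => repr.{w} (X j)) j ≫ sigmaReprToHomRestr T X ≫ f =
      reprToHomRestr T (X j) ≫ (homRestr T).map (Sigma.ι (fun j => (X j).obj) j) ≫ f := by
  rw [← Category.assoc, ι_sigmaReprToHomRestr, Category.assoc]

open scoped Classical in
instance : Mono (sigmaReprToHomRestr T X) := by
  refine (mono_iff _).2 fun Y x hx => eq_zero_of_π_eq_zero _ Y x fun j => ?_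
  have h : Sigma.π (fun j => repr.{w} (X j)) j ≫ reprToHomRestr T (X j) =
      sigmaReprToHomRestr T X ≫ (homRestr T).map (Sigma.π (fun j => (X j).obj) j) := by
    refine Sigma.hom_ext _ _ fun i => ?_
    rw [ι_sigmaReprToHomRestr_assoc, ← Functor.map_comp, Sigma.ι_π, Sigma.ι_π_assoc]
    by_cases h : i = j
    · subst h
      simp
    · simp [h]
  refine (mono_iff (reprToHomRestr T (X j))).1 inferInstance Y _ ?_
  rw [← comp_app_apply, h, comp_app_apply, hx, map_zero]

variable {T}

/-- Objects of `T` are finitely generated, so a morphism from one of them to the sum is a finite sum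
of morphisms into the summands. -/
lemma IsTilting.epi_sigmaReprToHomRestr (hT : IsTilting T) : Epi (sigmaReprToHomRestr T X) := by
  classical
  refine epi_of_surjective _ fun Y y => ?_
  obtain ⟨a, rfl⟩ := (homElem.{w} T.ι _ Y).surjective y
  obtain ⟨n, Z, S, p, hS, -, -, ⟨e⟩, m, Z', q, hq⟩ :=
    (hT.isFinPres Y.obj Y.property).exists_shortExact
  obtain ⟨s, hs⟩ := exists_comp_finiteTruncation (fun j => (X j).obj) (q ≫ e.hom) a
  let H : AddSubgroup (Y.obj ⟶ ∐ fun j => (X j).obj) :=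
    { carrier := { b | ∃ x, (sigmaReprToHomRestr T X).hom.app (op Y) x = homElem.{w} T.ι _ Y b }
      zero_mem' := ⟨0, by rw [map_zero, homElem_zero]⟩
      add_mem' := by
        rintro b b' ⟨x, hx⟩ ⟨x', hx'⟩
        exact ⟨x + x', by rw [map_add, hx, hx', homElem_add]⟩
      neg_mem' := by
        rintro b ⟨x, hx⟩
        refine ⟨-x, ?_⟩
        rw [map_neg, hx, neg_eq_iff_add_eq_zero, ← homElem_add, add_neg_cancel, homElem_zero] }
  change a ∈ H
  rw [← hs, finiteTruncation, Preadditive.comp_sum]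
  refine H.sum_mem fun j _ => ?_
  -- Since `T` is a full subcategory, the `j`-th component of `a` is itself an element of the
  -- representable module at `X j`.
  refine ⟨(Sigma.ι (fun j => repr.{w} (X j)) j).hom.app (op Y) (homElem.{w} (𝟭 _) (X j) Y
    (ObjectProperty.homMk (a ≫ Sigma.π (fun j => (X j).obj) j))), ?_⟩
  rw [← comp_app_apply, ι_sigmaReprToHomRestr, comp_app_apply, reprToHomRestr_homElem,
    homFunctor_map_homElem]
  simp

lemma IsTilting.isIso_sigmaReprToHomRestr (hT : IsTilting T) : IsIso (sigmaReprToHomRestr T X) := by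
  have := hT.epi_sigmaReprToHomRestr X
  exact isIso_of_mono_of_epi _

variable (T)

/-- The comparison map from the tensor product of a sum of representable modules. -/
noncomputable def tensorSigma :
    (tensor T).obj (∐ fun j => repr.{w} (X j)) ⟶ ∐ fun j => (X j).obj :=
  ((tensorAdj T).homEquiv _ _).symm (sigmaReprToHomRestr T X)

lemma unit_tensorSigma :
    (tensorAdj T).unit.app (∐ fun j => repr.{w} (X j)) ≫ (homRestr T).map (tensorSigma T X) =
      sigmaReprToHomRestr T X :=
  ((tensorAdj T).homEquiv_unit _ _ _).symm.trans (Equiv.apply_symm_apply _ _)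

/-- The inverse of `tensorSigma`. -/
noncomputable def tensorSigmaInv :
    (∐ fun j => (X j).obj) ⟶ (tensor T).obj (∐ fun j => repr.{w} (X j)) :=
  Sigma.desc fun j => (reprCorepresentable.{w} T.ι (X j)).homEquiv.symm
    ((tensorAdj T).unit.app (repr.{w} (X j))) ≫ (tensor T).map (Sigma.ι (fun j => repr.{w} (X j)) j)

lemma sigmaReprToHomRestr_map_tensorSigmaInv :
    sigmaReprToHomRestr T X ≫ (homRestr T).map (tensorSigmaInv T X) =
      (tensorAdj T).unit.app (∐ fun j => repr.{w} (X j)) := by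
  refine Sigma.hom_ext _ _ fun j => ?_
  rw [ι_sigmaReprToHomRestr_assoc, ← Functor.map_comp, tensorSigmaInv, Sigma.ι_desc,
    Functor.map_comp, ← Category.assoc, ← reprCorepresentable_homEquiv, Equiv.apply_symm_apply]
  exact ((tensorAdj T).unit.naturality _).symm

/-- The tensor product of a sum of representable modules is the corresponding sum of objects. -/
noncomputable def tensorSigmaIso :
    (tensor T).obj (∐ fun j => repr.{w} (X j)) ≅ ∐ fun j => (X j).obj where
  hom := tensorSigma T X
  inv := tensorSigmaInv T X
  hom_inv_id := by
    apply ((tensorAdj T).homEquiv _ _).injective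
    refine ((tensorAdj T).homEquiv_naturality_right _ _).trans ?_
    rw [tensorSigma, Equiv.apply_symm_apply, sigmaReprToHomRestr_map_tensorSigmaInv]
    exact ((tensorAdj T).homEquiv_id _).symm
  inv_hom_id := by
    refine Sigma.hom_ext _ _ fun j => (reprCorepresentable.{w} T.ι (X j)).homEquiv.injective ?_
    rw [reprCorepresentable_homEquiv, reprCorepresentable_homEquiv, Functor.map_comp,
      Functor.map_comp, ← Category.assoc, ← ι_sigmaReprToHomRestr, Category.assoc,
      reassoc_of% sigmaReprToHomRestr_map_tensorSigmaInv T X, Category.comp_id,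
      ← ι_sigmaReprToHomRestr]
    exact congrArg _ (unit_tensorSigma T X)

/-- The left adjoint preserves the canonical cover, and sends the covering sum of representables to
a sum of objects of `T`. -/
lemma torsionClass_tensor (N : CatMod.{w} T.FullSubcategory) :
    torsionClass T ((tensor T).obj N) := by
  have : (tensor T).PreservesEpimorphisms :=
    Functor.preservesEpimorphisms_of_adjunction (tensorAdj T)
  let J := Σ X : SmallModel.{w} T.FullSubcategory,
    N.obj.obj (op ((equivSmallModel T.FullSubcategory).inverse.obj X))
  let X (j : J) : T.FullSubcategory := (equivSmallModel T.FullSubcategory).inverse.obj j.1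
  exact torsionClass_of_epi (torsionClass_sigma (fun j => (X j).obj) fun j => (X j).property)
    ((tensorSigmaIso T X).inv ≫ (tensor T).map (coverπ N))

variable {T} (hT : IsTilting T)
include hT

lemma IsTilting.isIso_unit_sigma :
    IsIso ((tensorAdj T).unit.app (∐ fun j => repr.{w} (X j))) := by
  have := hT.isIso_sigmaReprToHomRestr X
  rw [← sigmaReprToHomRestr_map_tensorSigmaInv]
  exact inferInstanceAs (IsIso (sigmaReprToHomRestr T X ≫ (homRestr T).map (tensorSigmaIso T X).inv))

lemma IsTilting.isIso_unit_cover (N : CatMod.{w} T.FullSubcategory) :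
    IsIso ((tensorAdj T).unit.app (cover N)) :=
  hT.isIso_unit_sigma _

end CatMod

/-! ### Vanishing of `Tor₁` on submodules of `Hom(-, M)`. -/

namespace CatMod

variable {C : Type u} [Category.{v} C] [Preadditive C] [EssentiallySmall.{w} C]
variable (T : ObjectProperty (CatMod.{w} C)) [EssentiallySmall.{w} T.FullSubcategory]

noncomputable instance : PreservesColimitsOfSize.{0, 0} (tensor T) :=
  (tensorAdj T).leftAdjoint_preservesColimits

instance : PreservesFiniteColimits (tensor T) :=
  PreservesColimitsOfSize.preservesFiniteColimits _

noncomputable instance : PreservesLimitsOfSize.{0, 0} (homRestr T) :=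
  (tensorAdj T).rightAdjoint_preservesLimits

instance : PreservesFiniteLimits (homRestr T) :=
  PreservesLimitsOfSize.preservesFiniteLimits _

/-- The morphism `X ⟶ N ⊗ T` attached to an element of `N(X)`. -/
noncomputable def etaHom (N : CatMod.{w} T.FullSubcategory) {X : T.FullSubcategory}
    (y : N.obj.obj (op X)) : X.obj ⟶ (tensor T).obj N :=
  (homElem.{w} T.ι _ X).symm (((tensorAdj T).unit.app N).hom.app (op X) y)

lemma homElem_etaHom (N : CatMod.{w} T.FullSubcategory) {X : T.FullSubcategory}
    (y : N.obj.obj (op X)) :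
    homElem.{w} T.ι _ X (etaHom T N y) = ((tensorAdj T).unit.app N).hom.app (op X) y :=
  Equiv.apply_symm_apply _ _

lemma etaHom_map (N : CatMod.{w} T.FullSubcategory) {X Y : T.FullSubcategory} (f : X ⟶ Y)
    (y : N.obj.obj (op Y)) : etaHom T N (N.obj.map f.op y) = f.hom ≫ etaHom T N y := by
  apply (homElem.{w} T.ι _ X).injective
  rw [homElem_etaHom]
  refine (NatTrans.naturality_apply ((tensorAdj T).unit.app N).hom f.op y).trans ?_
  change ((homRestr T).obj ((tensor T).obj N)).obj.map f.op
    (((tensorAdj T).unit.app N).hom.app (op Y) y) = _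
  rw [← homElem_etaHom]
  exact map_homElem _ _ _

lemma etaHom_app {N N' : CatMod.{w} T.FullSubcategory} (g : N ⟶ N') {X : T.FullSubcategory}
    (y : N.obj.obj (op X)) : etaHom T N' (g.hom.app (op X) y) = etaHom T N y ≫ (tensor T).map g := by
  apply (homElem.{w} T.ι _ X).injective
  rw [homElem_etaHom, ← homFunctor_map_homElem, homElem_etaHom]
  have h := (tensorAdj T).unit.naturality g
  exact ConcreteCategory.congr_hom (congrArg (fun k => k.hom.app (op X)) h) y

lemma etaHom_injective (N : CatMod.{w} T.FullSubcategory) [Mono ((tensorAdj T).unit.app N)]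
    {X : T.FullSubcategory} : Function.Injective (etaHom T N (X := X)) := by
  intro y y' h
  have h' := congrArg (homElem.{w} T.ι _ X) h
  rw [homElem_etaHom, homElem_etaHom] at h'
  rw [← sub_eq_zero]
  refine (mono_iff ((tensorAdj T).unit.app N)).1 inferInstance X _ ?_
  rw [map_sub, h', sub_self]

lemma etaHom_surjective (N : CatMod.{w} T.FullSubcategory) [Epi ((tensorAdj T).unit.app N)]
    {X : T.FullSubcategory} : Function.Surjective (etaHom T N (X := X)) := by
  intro a
  obtain ⟨y, hy⟩ := surjective_app_of_epi ((tensorAdj T).unit.app N) (op X) (homElem.{w} T.ι _ X a)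
  exact ⟨y, by rw [etaHom, hy]; exact Equiv.symm_apply_apply _ _⟩

variable {T}

/-- Surjectivity of the unit at `N` is not available yet. So `x` is lifted to the tensor product of
the canonical cover, extended there to `S.X₂` because that module is torsion, identified with an
element by the invertible unit, and mapped back to `N`. -/
lemma IsTilting.exists_comp_etaHom (hT : IsTilting T) {S : ShortComplex (CatMod.{w} C)}
    (hS : S.ShortExact) (h₂ : T S.X₂) (h₃ : T S.X₃) [Projective S.X₁]
    (N : CatMod.{w} T.FullSubcategory) (x : S.X₁ ⟶ (tensor T).obj N) :
    ∃ y : N.obj.obj (op ⟨S.X₂, h₂⟩), S.f ≫ etaHom T N y = x := by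
  have := hT.isIso_unit_cover N
  let x' := Projective.factorThru x ((tensor T).map (coverπ N))
  obtain ⟨g, hg⟩ := hS.exists_extension
    ((hT.torsionClass_iff _).1 (torsionClass_tensor T (cover N)) _ h₃) x'
  obtain ⟨z, hz⟩ := etaHom_surjective T (cover N) (X := ⟨S.X₂, h₂⟩) g
  refine ⟨(coverπ N).hom.app _ z, ?_⟩
  rw [etaHom_app, hz, ← Category.assoc, hg]
  exact Projective.factorThru_comp _ _

/-- An element of the kernel at `X` is a map `x` from a representable; write it as `a` followed by
the map of some $y\in S_1(T_1)$. The image of $y$ in $S_2(T_1)$ then comes from $z\in S_2(T_2)$.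
Once $z$ is known to lie in $S_1(T_2)$, `x` factors through `a ≫ p = 0`. -/
lemma IsTilting.mono_tensor_map (hT : IsTilting T) {S : ShortComplex (CatMod.{w} T.FullSubcategory)}
    (hS : S.ShortExact) [IsIso ((tensorAdj T).unit.app S.X₂)] {M : CatMod.{w} C}
    (i : S.X₃ ⟶ (homRestr T).obj M) [Mono i] : Mono ((tensor T).map S.f) := by
  refine (mono_iff _).2 fun X x hx => ?_
  obtain ⟨T₁, T₂, a, p, w, hT₁, hT₂, hR⟩ := hT.exists_resolution X
  have hp := hR.epi_g
  obtain ⟨x, rfl⟩ := (yonedaEquiv _ _).surjective x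
  rw [← yonedaEquiv_comp] at hx
  have hx' : x ≫ (tensor T).map S.f = 0 := (yonedaEquiv _ _).injective hx
  have : Projective (ShortComplex.mk a p w).X₁ := inferInstanceAs (Projective (repr X))
  obtain ⟨y, hy⟩ := hT.exists_comp_etaHom hR hT₁ hT₂ S.X₁ x
  let X₁ : T.FullSubcategory := ⟨T₁, hT₁⟩
  let X₂ : T.FullSubcategory := ⟨T₂, hT₂⟩
  let q : X₁ ⟶ X₂ := ObjectProperty.homMk p
  change S.X₁.obj.obj (op X₁) at y
  change a ≫ etaHom T S.X₁ y = x at hy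
  have h₁ : a ≫ etaHom T S.X₂ (S.f.hom.app _ y) = 0 := by
    rw [etaHom_app, reassoc_of% hy, hx']
  obtain ⟨z', hz'⟩ : ∃ z' : T₂ ⟶ (tensor T).obj S.X₂, p ≫ z' = etaHom T S.X₂ (S.f.hom.app _ y) :=
    ⟨hR.exact.desc _ h₁, hR.exact.g_desc _ h₁⟩
  obtain ⟨z, rfl⟩ := etaHom_surjective T S.X₂ (X := X₂) z'
  have hz : S.X₂.obj.map q.op z = S.f.hom.app _ y := by
    apply etaHom_injective T S.X₂
    rw [etaHom_map, ← hz']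
    rfl
  have hk : S.X₃.obj.map q.op (S.g.hom.app _ z) = 0 := by
    rw [← NatTrans.naturality_apply, hz, ← comp_app_apply, S.zero, zero_app_apply]
  -- Restriction along the epi `p` is injective on `Hom(-, M)`, hence on its submodule `S.X₃`.
  have hk' : S.g.hom.app _ z = 0 := by
    obtain ⟨b, hb⟩ := (homElem.{w} T.ι M X₂).surjective (i.hom.app _ (S.g.hom.app _ z))
    have h₂ := congrArg (i.hom.app _) hk
    rw [NatTrans.naturality_apply, ← hb, map_homElem, map_zero, ← homElem_zero] at h₂
    have h₃ : p ≫ b = 0 := (homElem.{w} T.ι M X₁).injective h₂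
    refine (mono_iff i).1 inferInstance _ _ ?_
    rw [← hb, ← homElem_zero]
    congr 1
    rw [← cancel_epi p, h₃, comp_zero]
  obtain ⟨z₀, hz₀⟩ := (exact_iff_forall S).1 hS.exact _ _ hk'
  have hy' : S.X₁.obj.map q.op z₀ = y := by
    have := hS.mono_f
    rw [← sub_eq_zero]
    refine (mono_iff S.f).1 inferInstance _ _ ?_
    rw [map_sub, NatTrans.naturality_apply, hz₀, hz, sub_self]
  have hx₀ : x = 0 := by
    rw [← hy, ← hy', etaHom_map]
    change a ≫ p ≫ _ = 0
    rw [reassoc_of% w, zero_comp]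
  rw [hx₀]
  rfl

/-- The short exact sequence given by the canonical cover of a module. -/
noncomputable abbrev coverComplex {A : Type u} [Category.{v} A] [Preadditive A]
    [EssentiallySmall.{w} A] (N : CatMod.{w} A) : ShortComplex (CatMod.{w} A) :=
  ShortComplex.mk (kernel.ι (coverπ N)) (coverπ N) (kernel.condition _)

lemma coverComplex_shortExact {A : Type u} [Category.{v} A] [Preadditive A]
    [EssentiallySmall.{w} A] (N : CatMod.{w} A) : (coverComplex N).ShortExact where
  exact := ShortComplex.exact_kernel _

lemma IsTilting.isZero_tor_of_mono (hT : IsTilting T) {N : CatMod.{w} T.FullSubcategory}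
    {M : CatMod.{w} C} (i : N ⟶ (homRestr T).obj M) [Mono i] : IsZero ((tor T 1).obj N) := by
  have : IsIso ((tensorAdj T).unit.app (coverComplex N).X₂) := hT.isIso_unit_cover N
  exact ((tensor T).leftDerivedOne_isZero_iff (coverComplex_shortExact N)).2
    (hT.mono_tensor_map (coverComplex_shortExact N) i)

end CatMod

/-! ### Equivalences between full subcategories from objectwise isomorphisms. -/

section General

variable {A : Type u} [Category.{v} A] {B : Type u'} [Category.{v'} B]

/-- The isomorphisms may depend on the membership proofs, so comparisons built from chosen exact
sequences can be used. -/
lemma InduceEquivalence.of_iso {P : ObjectProperty A} {Q : ObjectProperty B} {F : A ⥤ B}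
    {G : B ⥤ A} (hF : ∀ X, P X → Q (F.obj X)) (hG : ∀ Y, Q Y → P (G.obj Y))
    (e : ∀ X, P X → (X ≅ G.obj (F.obj X)))
    (he : ∀ X X' (hX : P X) (hX' : P X') (f : X ⟶ X'),
      f ≫ (e X' hX').hom = (e X hX).hom ≫ G.map (F.map f))
    (e' : ∀ Y, Q Y → (F.obj (G.obj Y) ≅ Y))
    (he' : ∀ Y Y' (hY : Q Y) (hY' : Q Y') (f : Y ⟶ Y'),
      F.map (G.map f) ≫ (e' Y' hY').hom = (e' Y hY).hom ≫ f) :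
    InduceEquivalence P Q F G :=
  ⟨fun X => hF X.obj X.property, fun Y => hG Y.obj Y.property,
    ⟨NatIso.ofComponents (fun X => P.isoMk (e X.obj X.property)) fun {X X'} f => by
      ext1
      exact he _ _ X.property X'.property f.hom⟩,
    ⟨NatIso.ofComponents (fun Y => Q.isoMk (e' Y.obj Y.property)) fun {Y Y'} f => by
      ext1
      exact he' _ _ Y.property Y'.property f.hom⟩⟩

end General

/-! ### Unit and counit: the first equivalence, the vanishing statements and the torsion theory. -/

namespace CatMod

variable {C : Type u} [Category.{v} C] [Preadditive C] [EssentiallySmall.{w} C]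
variable {T : ObjectProperty (CatMod.{w} C)} [EssentiallySmall.{w} T.FullSubcategory]

lemma isZero_of_mono_eq_zero {A : Type*} [Category* A] [HasZeroMorphisms A] {X Y : A} (f : X ⟶ Y)
    [Mono f] (h : f = 0) : IsZero X := by
  rw [IsZero.iff_id_eq_zero, ← cancel_mono f, h, comp_zero, comp_zero]

lemma isZero_of_epi_eq_zero {A : Type*} [Category* A] [HasZeroMorphisms A] {X Y : A} (f : X ⟶ Y)
    [Epi f] (h : f = 0) : IsZero Y := by
  rw [IsZero.iff_id_eq_zero, ← cancel_epi f, h, zero_comp, zero_comp]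

variable (T) in
/-- The unit of the adjunction between the tensor functor and its right adjoint. -/
noncomputable abbrev unitMap (N : CatMod.{w} T.FullSubcategory) :
    N ⟶ (homRestr T).obj ((tensor T).obj N) :=
  (tensorAdj T).unit.app N

variable (T) in
/-- The counit of the adjunction between the tensor functor and its right adjoint. -/
noncomputable abbrev counitMap (M : CatMod.{w} C) :
    (tensor T).obj ((homRestr T).obj M) ⟶ M :=
  (tensorAdj T).counit.app M

variable (T) in
/-- The connecting morphism from `Tor₁(-, T)`. -/
noncomputable def torι {S : ShortComplex (CatMod.{w} T.FullSubcategory)} (hS : S.ShortExact) :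
    (tor T 1).obj S.X₃ ⟶ (tensor T).obj S.X₁ :=
  (tensor T).leftDerivedOneι hS

section

variable {S : ShortComplex (CatMod.{w} T.FullSubcategory)} (hS : S.ShortExact)

@[simp]
lemma torι_map : torι T hS ≫ (tensor T).map S.f = 0 :=
  (tensor T).leftDerivedOneι_map hS

lemma torι_map_assoc {Z : CatMod.{w} C} (f : (tensor T).obj S.X₂ ⟶ Z) :
    torι T hS ≫ (tensor T).map S.f ≫ f = 0 := by
  rw [← Category.assoc, torι_map, zero_comp]

lemma mono_torι [Projective S.X₂] : Mono (torι T hS) :=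
  (tensor T).mono_leftDerivedOneι hS

lemma exists_lift_torι [Projective S.X₂] {Z : CatMod.{w} C} (z : Z ⟶ (tensor T).obj S.X₁)
    (hz : z ≫ (tensor T).map S.f = 0) : ∃ l, l ≫ torι T hS = z :=
  (tensor T).exists_lift_leftDerivedOneι hS z hz

lemma torι_naturality {S' : ShortComplex (CatMod.{w} T.FullSubcategory)} (hS' : S'.ShortExact)
    (φ : S ⟶ S') : (tor T 1).map φ.τ₃ ≫ torι T hS' = torι T hS ≫ (tensor T).map φ.τ₁ :=
  (tensor T).leftDerivedOneι_naturality hS hS' φ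

include hS in
lemma isZero_tor_iff [Projective S.X₂] :
    IsZero ((tor T 1).obj S.X₃) ↔ Mono ((tensor T).map S.f) :=
  (tensor T).leftDerivedOne_isZero_iff hS

include hS in
lemma mono_tensor_map_of_isZero_tor (h : IsZero ((tor T 1).obj S.X₃)) :
    Mono ((tensor T).map S.f) :=
  (tensor T).mono_map_of_isZero_leftDerivedOne hS h

end

/-- A part of the five lemma. -/
lemma mono_τ₃ {A : Type u'} [Category.{v'} A] [Preadditive A] {S S' : ShortComplex (CatMod.{w} A)}
    (φ : S ⟶ S') [Epi S.g] (hS' : S'.Exact) [Epi φ.τ₁] [Mono φ.τ₂] : Mono φ.τ₃ := by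
  refine (mono_iff _).2 fun X n hn => ?_
  obtain ⟨p, rfl⟩ := surjective_app_of_epi S.g (op X) n
  rw [← comp_app_apply, ← φ.comm₂₃, comp_app_apply] at hn
  obtain ⟨k', hk'⟩ := (exact_iff_forall S').1 hS' X _ hn
  obtain ⟨k, rfl⟩ := surjective_app_of_epi φ.τ₁ (op X) k'
  rw [← comp_app_apply, φ.comm₁₂, comp_app_apply] at hk'
  have h : S.f.hom.app (op X) k = p := by
    rw [← sub_eq_zero]
    refine (mono_iff φ.τ₂).1 inferInstance X _ ?_
    rw [map_sub, hk', sub_self]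
  rw [← h, ← comp_app_apply, S.zero, zero_app_apply]

lemma unit_naturality {N N' : CatMod.{w} T.FullSubcategory} (f : N ⟶ N') :
    f ≫ unitMap T N' = unitMap T N ≫
      (homRestr T).map ((tensor T).map f) :=
  (tensorAdj T).unit.naturality f

lemma counit_naturality {M M' : CatMod.{w} C} (f : M ⟶ M') :
    (tensor T).map ((homRestr T).map f) ≫ counitMap T M' =
      counitMap T M ≫ f :=
  (tensorAdj T).counit.naturality f

lemma unit_comp_counit (M : CatMod.{w} C) :
    unitMap T ((homRestr T).obj M) ≫ (homRestr T).map (counitMap T M) =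
      𝟙 _ :=
  (tensorAdj T).right_triangle_components M

lemma unit_comp_counit' (N : CatMod.{w} T.FullSubcategory) :
    (tensor T).map (unitMap T N) ≫ counitMap T ((tensor T).obj N) =
      𝟙 _ :=
  (tensorAdj T).left_triangle_components N

/-- Each `X j ⟶ M` is an element of `Hom(-, M)|_T`, and by the triangle identity it factors through
the counit. -/
lemma epi_counit {M : CatMod.{w} C} (hM : torsionClass T M) :
    Epi (counitMap T M) := by
  obtain ⟨J, X, p, hX, hp⟩ := hM
  have h (j : J) : ∃ f, f ≫ counitMap T M = Sigma.ι X j ≫ p := by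
    refine ⟨etaHom T _ (homElem.{w} T.ι M ⟨X j, hX j⟩ (Sigma.ι X j ≫ p)), ?_⟩
    apply (homElem.{w} T.ι M ⟨X j, hX j⟩).injective
    refine (homFunctor_map_homElem.{w} T.ι _ _).symm.trans ?_
    refine (congrArg _ (homElem_etaHom T _ _)).trans ?_
    exact ConcreteCategory.congr_hom (congrArg (fun k => k.hom.app (op ⟨X j, hX j⟩))
      (unit_comp_counit (T := T) M)) _
  choose f hf using h
  have : Sigma.desc f ≫ counitMap T M = p :=
    Sigma.hom_ext _ _ fun j => by rw [Sigma.ι_desc_assoc, hf]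
  exact epi_of_epi_fac this

variable (hT : IsTilting T)
include hT

lemma IsTilting.isZero_tor_homRestr (M : CatMod.{w} C) :
    IsZero ((tor T 1).obj ((homRestr T).obj M)) :=
  hT.isZero_tor_of_mono (𝟙 _)

omit [EssentiallySmall.{w} T.FullSubcategory] in
lemma IsTilting.isZero_extRestr_iff_torsionClass (M : CatMod.{w} C) :
    IsZero ((extRestr T 1).obj M) ↔ torsionClass T M :=
  (isZero_extRestr_iff T M).trans (hT.torsionClass_iff M).symm

lemma IsTilting.isZero_extRestr_tensor (N : CatMod.{w} T.FullSubcategory) :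
    IsZero ((extRestr T 1).obj ((tensor T).obj N)) :=
  (hT.isZero_extRestr_iff_torsionClass _).2 (torsionClass_tensor T N)

/-- For the cover $P\to N$, the kernel of $G(P)\to G(N)$ is a quotient of a tensor product, hence
torsion. So $FG(P)\to FG(N)$ is epi, and the unit at $P$ is invertible. -/
lemma IsTilting.epi_unit (N : CatMod.{w} T.FullSubcategory) : Epi (unitMap T N) := by
  have := hT.isIso_unit_cover N
  have hex := (coverComplex_shortExact N).exact.map_of_epi_of_preservesCokernel (tensor T)
    (inferInstanceAs (Epi (coverπ N))) inferInstance
  have hepi : Epi (kernel.lift ((tensor T).map (coverπ N)) ((tensor T).map (coverComplex N).f)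
    (by rw [← Functor.map_comp, (coverComplex N).zero, Functor.map_zero])) := hex.epi_kernelLift
  have hS : (ShortComplex.mk (kernel.ι ((tensor T).map (coverπ N))) _
      (kernel.condition _)).ShortExact :=
    { exact := ShortComplex.exact_kernel _ }
  have h := epi_homRestr_map T hS ((hT.isZero_extRestr_iff_torsionClass _).2
    (torsionClass_of_epi (torsionClass_tensor T _) (kernel.lift ((tensor T).map (coverπ N))
      ((tensor T).map (coverComplex N).f) _)))
  have h' : Epi ((homRestr T).map ((tensor T).map (coverπ N))) := h
  have : Epi (coverπ N ≫ unitMap T N) := by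
    rw [unit_naturality]
    infer_instance
  exact epi_of_epi (coverπ N) _

lemma IsTilting.isIso_unit_of_mono {N : CatMod.{w} T.FullSubcategory} {M : CatMod.{w} C}
    (i : N ⟶ (homRestr T).obj M) [Mono i] : IsIso (unitMap T N) := by
  have := hT.epi_unit N
  have h : unitMap T N ≫
      (homRestr T).map (((tensorAdj T).homEquiv _ _).symm i) = i :=
    ((tensorAdj T).homEquiv_unit _ _ _).symm.trans (Equiv.apply_symm_apply _ _)
  have : Mono (unitMap T N) := mono_of_mono_fac h
  exact isIso_of_mono_of_epi _

lemma IsTilting.isIso_unit_of_shortExact {S : ShortComplex (CatMod.{w} T.FullSubcategory)}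
    (hS : S.ShortExact) [IsIso (unitMap T S.X₂)] : IsIso (unitMap T S.X₁) := by
  have := hS.mono_f
  have : Mono (S.f ≫ unitMap T S.X₂) := mono_comp _ _
  exact hT.isIso_unit_of_mono (S.f ≫ unitMap T S.X₂)

/-- Vanishing of `Tor₁` keeps the cover sequence left exact after `tensor T`; the left exact
`homRestr T` then allows a five lemma comparison with the original sequence. -/
lemma IsTilting.isIso_unit_of_classY {N : CatMod.{w} T.FullSubcategory} (hN : classY T N) :
    IsIso (unitMap T N) := by
  have := hT.epi_unit N
  let S := coverComplex N
  have hS : S.ShortExact := coverComplex_shortExact N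
  have : IsIso (unitMap T S.X₂) := hT.isIso_unit_cover N
  have := hT.isIso_unit_of_shortExact hS
  have : Projective S.X₂ := inferInstanceAs (Projective (cover N))
  have hm : Mono ((tensor T).map S.f) := (isZero_tor_iff hS).1 hN
  have hG : (S.map (tensor T)).Exact := hS.exact.map_of_epi_of_preservesCokernel (tensor T)
    hS.epi_g inferInstance
  have hFG : ((S.map (tensor T)).map (homRestr T)).Exact :=
    hG.map_of_mono_of_preservesKernel (homRestr T) hm inferInstance
  let φ : S ⟶ (S.map (tensor T)).map (homRestr T) :=
    { τ₁ := unitMap T S.X₁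
      τ₂ := unitMap T S.X₂
      τ₃ := unitMap T S.X₃
      comm₁₂ := (unit_naturality _).symm
      comm₂₃ := (unit_naturality _).symm }
  have : Epi φ.τ₁ := inferInstanceAs (Epi (unitMap T S.X₁))
  have : Mono φ.τ₂ := inferInstanceAs (Mono (unitMap T (cover N)))
  have := hS.epi_g
  have : Mono φ.τ₃ := mono_τ₃ φ hFG
  have : Mono (unitMap T N) := this
  exact isIso_of_mono_of_epi _

/-- Since `homRestr T` inverts the counit and `Ext¹(-, ·)|_T` vanishes on tensor products, both
functors vanish on the kernel of the counit. That kernel is therefore torsion and torsion-free. -/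
lemma IsTilting.isIso_counit {M : CatMod.{w} C} (hM : torsionClass T M) :
    IsIso (counitMap T M) := by
  have hepi := epi_counit hM
  let S := ShortComplex.mk (kernel.ι (counitMap T M)) _ (kernel.condition _)
  have hS : S.ShortExact := { exact := ShortComplex.exact_kernel _ }
  have := hT.isIso_unit_of_classY (hT.isZero_tor_homRestr M)
  have hiso : IsIso ((homRestr T).map S.g) :=
    (isIso_comp_left_iff (unitMap T ((homRestr T).obj M)) _).1 (by
      change IsIso (unitMap T ((homRestr T).obj M) ≫
        (homRestr T).map (counitMap T M))
      rw [unit_comp_counit]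
      infer_instance)
  have hF : IsZero ((homRestr T).obj S.X₁) := by
    have := hS.mono_f
    refine isZero_of_mono_eq_zero ((homRestr T).map S.f) ?_
    rw [← cancel_mono ((homRestr T).map S.g), ← Functor.map_comp, S.zero, Functor.map_zero,
      zero_comp]
  have hF' : IsZero ((extRestr T 1).obj S.X₁) := by
    have := epi_connecting T hS (hT.isZero_extRestr_tensor _)
    refine isZero_of_epi_eq_zero (connecting T hS) ?_
    rw [← cancel_epi ((homRestr T).map S.g), map_comp_connecting, comp_zero]
  have h₁ : torsionFreeClass T S.X₁ := (torsionFreeClass_iff _).2 ((isZero_homRestr_iff T _).1 hF)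
  have h₂ := h₁ _ ((hT.isZero_extRestr_iff_torsionClass _).1 hF') (𝟙 _)
  have h₃ : kernel.ι (counitMap T M) = 0 :=
    (Category.id_comp S.f).symm.trans ((congrArg (· ≫ S.f) h₂).trans zero_comp)
  have := Preadditive.mono_of_kernel_zero h₃
  exact isIso_of_mono_of_epi _

/-- `Tor₁` is the kernel of `(tensor T).map S.f`, and the units identify `homRestr T` of that map
with the mono `S.f`. -/
lemma IsTilting.isZero_homRestr_tor_of_shortExact
    {S : ShortComplex (CatMod.{w} T.FullSubcategory)} (hS : S.ShortExact) [Projective S.X₂]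
    [IsIso (unitMap T S.X₂)] : IsZero ((homRestr T).obj ((tor T 1).obj S.X₃)) := by
  have := hT.isIso_unit_of_shortExact hS
  have := mono_torι hS
  have := hS.mono_f
  have h : (homRestr T).map ((tensor T).map S.f) = inv (unitMap T S.X₁) ≫ S.f ≫ unitMap T S.X₂ := by
    rw [unit_naturality, IsIso.inv_hom_id_assoc]
  have : Mono ((homRestr T).map ((tensor T).map S.f)) := by
    rw [h]
    infer_instance
  refine isZero_of_mono_eq_zero ((homRestr T).map (torι T hS)) ?_
  rw [← cancel_mono ((homRestr T).map ((tensor T).map S.f)), ← Functor.map_comp,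
    torι_map, Functor.map_zero, zero_comp]

lemma IsTilting.isZero_homRestr_tor (N : CatMod.{w} T.FullSubcategory) :
    IsZero ((homRestr T).obj ((tor T 1).obj N)) := by
  have : IsIso (unitMap T (coverComplex N).X₂) := hT.isIso_unit_cover N
  exact hT.isZero_homRestr_tor_of_shortExact (coverComplex_shortExact N)

/-- For an embedding of `M` in a torsion module `E` with quotient `∐ X`, `Ext¹(-, M)|_T` is the
cokernel of `(homRestr T).map p`, and the counits identify the tensor product of that map with the
epi `p`. -/
lemma IsTilting.isZero_tensor_extRestr (M : CatMod.{w} C) :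
    IsZero ((tensor T).obj ((extRestr T 1).obj M)) := by
  obtain ⟨J, X, E, i, p, w, hX, hE, hS⟩ := hT.exists_embedding M
  have := hT.isIso_counit hE
  have := hT.isIso_counit (torsionClass_sigma X hX)
  have hp : Epi p := hS.epi_g
  have := epi_connecting T hS ((hT.isZero_extRestr_iff_torsionClass _).2 hE)
  have h : (tensor T).map ((homRestr T).map p) =
      counitMap T E ≫ p ≫ inv (counitMap T (∐ X)) := by
    rw [← Category.assoc, ← counit_naturality, Category.assoc, IsIso.hom_inv_id, Category.comp_id]
  have : Epi ((tensor T).map ((homRestr T).map p)) := by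
    rw [h]
    infer_instance
  refine isZero_of_epi_eq_zero ((tensor T).map (connecting T hS)) ?_
  rw [← cancel_epi ((tensor T).map ((homRestr T).map p)), ← Functor.map_comp,
    map_comp_connecting T hS, Functor.map_zero, comp_zero]

lemma IsTilting.induceEquivalence_homRestr_tensor :
    InduceEquivalence (torsionClass T) (classY T) (homRestr T) (tensor T) := by
  have h₁ (M) (hM : torsionClass T M) := hT.isIso_counit hM
  have h₂ (N) (hN : classY T N) := hT.isIso_unit_of_classY hN
  exact InduceEquivalence.of_iso (fun M _ => hT.isZero_tor_homRestr M)
    (fun N _ => torsionClass_tensor T N)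
    (fun M hM => (@asIso _ _ _ _ _ (h₁ M hM)).symm)
    (fun M M' hM hM' f => by
      have := h₁ M hM
      have := h₁ M' hM'
      simp only [Iso.symm_hom, asIso_inv]
      rw [IsIso.comp_inv_eq, Category.assoc, counit_naturality, IsIso.inv_hom_id_assoc])
    (fun N hN => (@asIso _ _ _ _ _ (h₂ N hN)).symm)
    (fun N N' hN hN' f => by
      have := h₂ N hN
      have := h₂ N' hN'
      simp only [Iso.symm_hom, asIso_inv]
      rw [IsIso.comp_inv_eq, Category.assoc, unit_naturality, IsIso.inv_hom_id_assoc])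

lemma IsTilting.unit_shortExact (N : CatMod.{w} T.FullSubcategory) :
    (ShortComplex.mk (kernel.ι (unitMap T N)) (unitMap T N) (kernel.condition _)).ShortExact :=
  have := hT.epi_unit N
  { exact := ShortComplex.exact_kernel _ }

/-- The tensor product keeps the kernel inclusion mono, because `Tor₁` of the cokernel $FG(N)$
vanishes; it also sends the inclusion to zero, because it makes the unit a split mono. -/
lemma IsTilting.classX_kernel_unit (N : CatMod.{w} T.FullSubcategory) :
    classX T (kernel (unitMap T N)) := by
  have h := mono_tensor_map_of_isZero_tor (hT.unit_shortExact N) (hT.isZero_tor_homRestr _)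
  refine isZero_of_mono_eq_zero ((tensor T).map (kernel.ι (unitMap T N))) ?_
  have : Mono ((tensor T).map (unitMap T N)) := mono_of_mono_fac (unit_comp_counit' N)
  rw [← cancel_mono ((tensor T).map (unitMap T N)), ← Functor.map_comp, kernel.condition,
    Functor.map_zero, zero_comp]

lemma IsTilting.isTorsionTheory : IsTorsionTheory (classX T) (classY T) where
  hom_eq_zero X Y hX hY f := by
    have := hT.isIso_unit_of_classY hY
    rw [← cancel_mono (unitMap T Y), unit_naturality,
      hX.eq_of_src ((tensor T).map f) 0, Functor.map_zero, comp_zero, zero_comp]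
  left_maximal X h := by
    have h₁ := h _ (hT.isZero_tor_homRestr _) (unitMap T X)
    have h₂ := unit_comp_counit' X
    rw [h₁, Functor.map_zero, zero_comp] at h₂
    exact (IsZero.iff_id_eq_zero _).2 h₂.symm
  right_maximal Y h := by
    have := Preadditive.mono_of_kernel_zero (h _ (hT.classX_kernel_unit Y) (kernel.ι (unitMap T Y)))
    exact hT.isZero_tor_of_mono (unitMap T Y)
  exists_shortExact N := ⟨_, _, _, _, _, hT.classX_kernel_unit N, hT.isZero_tor_homRestr _,
    hT.unit_shortExact N⟩

end CatMod

/-! ### The second equivalence, between torsion-free modules and `classX`. -/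

namespace CatMod

variable {C : Type u} [Category.{v} C] [Preadditive C] [EssentiallySmall.{w} C]
variable {T : ObjectProperty (CatMod.{w} C)} [EssentiallySmall.{w} T.FullSubcategory]

section TorsionFree

variable {S : ShortComplex (CatMod.{w} C)} (hS : S.ShortExact)

variable (T) in
/-- The complex `0 → Hom(-, X₂)|_T → Hom(-, X₃)|_T → Ext¹(-, X₁)|_T → 0`. -/
noncomputable abbrev connectingComplex : ShortComplex (CatMod.{w} T.FullSubcategory) :=
  ShortComplex.mk ((homRestr T).map S.g) (connecting T hS) (map_comp_connecting T hS)

lemma connectingComplex_shortExact (h₁ : IsZero ((homRestr T).obj S.X₁))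
    (h₂ : IsZero ((extRestr T 1).obj S.X₂)) : (connectingComplex T hS).ShortExact where
  exact := connecting_exact T hS
  mono_f := by
    have := hS.mono_f
    exact (hS.exact.map_of_mono_of_preservesKernel (homRestr T) inferInstance inferInstance).mono_g
      (h₁.eq_of_src _ _)
  epi_g := epi_connecting T hS h₂

/-- A morphism of short exact sequences induces a morphism of connecting complexes. -/
@[simps]
noncomputable def connectingComplexMap {S' : ShortComplex (CatMod.{w} C)} (hS' : S'.ShortExact)
    (φ : S ⟶ S') : connectingComplex T hS ⟶ connectingComplex T hS' where
  τ₁ := (homRestr T).map φ.τ₂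
  τ₂ := (homRestr T).map φ.τ₃
  τ₃ := (extRestr T 1).map φ.τ₁
  comm₁₂ := by
    change (homRestr T).map φ.τ₂ ≫ (homRestr T).map S'.g = (homRestr T).map S.g ≫ _
    rw [← Functor.map_comp, ← Functor.map_comp, φ.comm₂₃]
  comm₂₃ := connecting_naturality T hS hS' φ

lemma torι_counit_comp (h : (connectingComplex T hS).ShortExact) :
    (torι T h ≫ counitMap T S.X₂) ≫ S.g = 0 := by
  rw [Category.assoc, ← counit_naturality]
  exact torι_map_assoc h _

/-- The comparison `Tor₁(Ext¹(-, X₁)|_T, T) ⟶ X₁`. -/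
noncomputable def torExtHom (h : (connectingComplex T hS).ShortExact) :
    (tor T 1).obj ((extRestr T 1).obj S.X₁) ⟶ S.X₁ :=
  have := hS.mono_f
  hS.exact.lift (torι T h ≫ counitMap T S.X₂) (torι_counit_comp hS h)

lemma torExtHom_f (h : (connectingComplex T hS).ShortExact) :
    torExtHom hS h ≫ S.f = torι T h ≫ counitMap T S.X₂ :=
  have := hS.mono_f
  hS.exact.lift_f _ _

lemma torExtHom_naturality (h : (connectingComplex T hS).ShortExact)
    {S' : ShortComplex (CatMod.{w} C)} (hS' : S'.ShortExact)
    (h' : (connectingComplex T hS').ShortExact) (φ : S ⟶ S') :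
    (tor T 1).map ((extRestr T 1).map φ.τ₁) ≫ torExtHom hS' h' = torExtHom hS h ≫ φ.τ₁ := by
  have := hS'.mono_f
  have h₁ := torι_naturality h h' (connectingComplexMap hS hS' φ)
  rw [← cancel_mono S'.f, Category.assoc, Category.assoc, torExtHom_f, φ.comm₁₂,
    ← Category.assoc (torExtHom hS h), torExtHom_f, Category.assoc, ← counit_naturality]
  exact (reassoc_of% h₁) _

/-- The connecting complex has projective middle term, so the `Tor₁` in question is the kernel of
`(tensor T).map ((homRestr T).map S.g)`. The counits identify this kernel with that of `S.g`, which
is `S.X₁`. -/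
lemma isIso_torExtHom (h : (connectingComplex T hS).ShortExact)
    [Projective ((homRestr T).obj S.X₃)] [IsIso (counitMap T S.X₂)] [IsIso (counitMap T S.X₃)] :
    IsIso (torExtHom hS h) := by
  have := hS.mono_f
  have : Projective (connectingComplex T hS).X₂ := inferInstanceAs (Projective ((homRestr T).obj S.X₃))
  have := mono_torι h
  have : Mono (torExtHom hS h ≫ S.f) := by
    rw [torExtHom_f]
    exact mono_comp _ _
  have : Mono (torExtHom hS h) := mono_of_mono _ S.f
  obtain ⟨l, hl⟩ := exists_lift_torι h (S.f ≫ inv (counitMap T S.X₂)) (by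
    change (S.f ≫ inv (counitMap T S.X₂)) ≫ (tensor T).map ((homRestr T).map S.g) = 0
    rw [← cancel_mono (counitMap T S.X₃), Category.assoc, Category.assoc, counit_naturality,
      IsIso.inv_hom_id_assoc, S.zero, zero_comp])
  have h₁ : l ≫ torExtHom hS h = 𝟙 _ := by
    rw [← cancel_mono S.f, Category.assoc, torExtHom_f, reassoc_of% hl, IsIso.inv_hom_id,
      Category.comp_id, Category.id_comp]
  have : IsSplitEpi (torExtHom hS h) := ⟨⟨⟨l, h₁⟩⟩⟩
  exact isIso_of_mono_of_isSplitEpi _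

lemma IsTilting.projective_homRestr_sigma (hT : IsTilting T) {J : Type w}
    (X : J → CatMod.{w} C) (hX : ∀ j, T (X j)) : Projective ((homRestr T).obj (∐ X)) := by
  let Y (j : J) : T.FullSubcategory := ⟨X j, hX j⟩
  have := hT.isIso_sigmaReprToHomRestr Y
  exact Projective.of_iso (asIso (sigmaReprToHomRestr T Y)) (projective_sigma _)

/-- The last clause, due to `Ext¹` from sums of objects of `T` to torsion modules being zero, serves
to extend morphisms to the chosen embeddings and so gives naturality. -/
lemma IsTilting.exists_isIso_torExtHom (hT : IsTilting T) {M : CatMod.{w} C}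
    (hM : torsionFreeClass T M) :
    ∃ (E Q : CatMod.{w} C) (i : M ⟶ E) (p : E ⟶ Q) (w : i ≫ p = 0)
      (hS : (ShortComplex.mk i p w).ShortExact) (h : (connectingComplex T hS).ShortExact),
      torsionClass T E ∧ IsIso (torExtHom hS h) ∧
        ∀ (E' : CatMod.{w} C) (f : M ⟶ E'), torsionClass T E' → ∃ g : E ⟶ E', i ≫ g = f := by
  obtain ⟨J, X, E, i, p, w, hX, hE, hS⟩ := hT.exists_embedding M
  have := hT.isIso_counit hE
  have := hT.isIso_counit (torsionClass_sigma X hX)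
  have := hT.projective_homRestr_sigma X hX
  have h := connectingComplex_shortExact hS
    ((isZero_homRestr_iff T M).2 ((torsionFreeClass_iff M).1 hM))
    ((hT.isZero_extRestr_iff_torsionClass _).2 hE)
  exact ⟨E, _, i, p, w, hS, h, hE, isIso_torExtHom hS h, fun E' f hE' => hS.exists_extension
    (ext_sigma_left_eq_zero fun j => (hT.torsionClass_iff E').1 hE' _ (hX j)) f⟩

end TorsionFree

section TensorZero

variable {S : ShortComplex (CatMod.{w} T.FullSubcategory)} (hS : S.ShortExact)

/-- The complex `0 → Tor₁(X₃, T) → X₁ ⊗ T → X₂ ⊗ T → 0`. -/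
noncomputable abbrev torComplex : ShortComplex (CatMod.{w} C) :=
  ShortComplex.mk (torι T hS) ((tensor T).map S.f) (torι_map hS)

lemma torComplex_shortExact [Projective S.X₂] (h : IsZero ((tensor T).obj S.X₃)) :
    (torComplex hS).ShortExact where
  exact := by
    have := mono_torι hS
    refine ShortComplex.exact_of_f_is_kernel _ (KernelFork.IsLimit.ofι' _ _ fun z hz => ?_)
    exact ⟨(exists_lift_torι hS z hz).choose, (exists_lift_torι hS z hz).choose_spec⟩
  mono_f := mono_torι hS
  epi_g := by
    have := hS.epi_g
    exact (hS.exact.map_of_epi_of_preservesCokernel (tensor T) inferInstance inferInstance).epi_f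
      (h.eq_of_tgt _ _)

/-- A morphism of short exact sequences induces a morphism of the associated complexes. -/
@[simps]
noncomputable def torComplexMap {S' : ShortComplex (CatMod.{w} T.FullSubcategory)}
    (hS' : S'.ShortExact) (φ : S ⟶ S') : torComplex hS ⟶ torComplex hS' where
  τ₁ := (tor T 1).map φ.τ₃
  τ₂ := (tensor T).map φ.τ₁
  τ₃ := (tensor T).map φ.τ₂
  comm₁₂ := torι_naturality hS hS' φ
  comm₂₃ := by
    change (tensor T).map φ.τ₁ ≫ (tensor T).map S'.f = (tensor T).map S.f ≫ _
    rw [← Functor.map_comp, ← Functor.map_comp, φ.comm₁₂]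

lemma comp_unit_connecting (h : (torComplex hS).ShortExact) :
    S.f ≫ unitMap T S.X₂ ≫ connecting T h = 0 := by
  rw [← Category.assoc, unit_naturality, Category.assoc]
  exact (congrArg _ (map_comp_connecting T h)).trans comp_zero

/-- The comparison `X₃ ⟶ Ext¹(-, Tor₁(X₃, T))|_T`. -/
noncomputable def extTorHom (h : (torComplex hS).ShortExact) :
    S.X₃ ⟶ (extRestr T 1).obj ((tor T 1).obj S.X₃) :=
  have := hS.epi_g
  hS.exact.desc (unitMap T S.X₂ ≫ connecting T h) (comp_unit_connecting hS h)

lemma g_extTorHom (h : (torComplex hS).ShortExact) :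
    S.g ≫ extTorHom hS h = unitMap T S.X₂ ≫ connecting T h :=
  have := hS.epi_g
  hS.exact.g_desc _ _

lemma extTorHom_naturality (h : (torComplex hS).ShortExact)
    {S' : ShortComplex (CatMod.{w} T.FullSubcategory)} (hS' : S'.ShortExact)
    (h' : (torComplex hS').ShortExact) (φ : S ⟶ S') :
    φ.τ₃ ≫ extTorHom hS' h' = extTorHom hS h ≫ (extRestr T 1).map ((tor T 1).map φ.τ₃) := by
  have := hS.epi_g
  have h₁ := connecting_naturality T h h' (torComplexMap hS hS' φ)
  rw [← cancel_epi S.g, ← Category.assoc, ← φ.comm₂₃, Category.assoc, g_extTorHom,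
    ← Category.assoc S.g, g_extTorHom, ← Category.assoc, unit_naturality, Category.assoc,
    Category.assoc]
  exact congrArg _ h₁

/-- By `h₁` the connecting morphism is a cokernel of `(homRestr T).map ((tensor T).map S.f)`, which
the units identify with `S.f`, whose cokernel is `S.X₃`. -/
lemma isIso_extTorHom (h : (torComplex hS).ShortExact) [IsIso (unitMap T S.X₁)]
    [IsIso (unitMap T S.X₂)] (h₁ : IsZero ((extRestr T 1).obj ((tensor T).obj S.X₁))) :
    IsIso (extTorHom hS h) := by
  have := hS.epi_g
  have := epi_connecting T h h₁
  have hepi : Epi (S.g ≫ extTorHom hS h) := by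
    rw [g_extTorHom]
    exact epi_comp _ _
  have : Epi (extTorHom hS h) := epi_of_epi S.g _
  have w : (homRestr T).map ((tensor T).map S.f) ≫ inv (unitMap T S.X₂) ≫ S.g = 0 := by
    rw [← cancel_epi (unitMap T S.X₁), ← Category.assoc, ← unit_naturality, Category.assoc,
      IsIso.hom_inv_id_assoc, S.zero, comp_zero]
  obtain ⟨m, hm⟩ : ∃ m, connecting T h ≫ m = inv (unitMap T S.X₂) ≫ S.g :=
    ⟨(connecting_exact T h).desc _ w, (connecting_exact T h).g_desc _ w⟩
  have h₂ : extTorHom hS h ≫ m = 𝟙 _ := by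
    rw [← cancel_epi S.g, ← Category.assoc, g_extTorHom, Category.assoc, hm,
      IsIso.hom_inv_id_assoc, Category.comp_id]
  have : IsSplitMono (extTorHom hS h) := ⟨⟨⟨m, h₂⟩⟩⟩
  exact isIso_of_epi_of_isSplitMono _

lemma IsTilting.isIso_extTorHom (hT : IsTilting T) {N : CatMod.{w} T.FullSubcategory}
    (h : (torComplex (coverComplex_shortExact N)).ShortExact) :
    IsIso (extTorHom (coverComplex_shortExact N) h) := by
  have : IsIso (unitMap T (coverComplex N).X₂) := hT.isIso_unit_cover N
  have := hT.isIso_unit_of_shortExact (coverComplex_shortExact N)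
  exact CatMod.isIso_extTorHom _ h (hT.isZero_extRestr_tensor _)

end TensorZero

lemma IsTilting.induceEquivalence_extRestr_tor (hT : IsTilting T) :
    InduceEquivalence (torsionFreeClass T) (classX T) (extRestr T 1) (tor T 1) := by
  choose E Q i p w hS h hE hiso hext using fun (M : CatMod.{w} C) (hM : torsionFreeClass T M) =>
    hT.exists_isIso_torExtHom hM
  have hX (N : CatMod.{w} T.FullSubcategory) (hN : classX T N) :
      (torComplex (coverComplex_shortExact N)).ShortExact := torComplex_shortExact _ hN
  have hiso' (N : CatMod.{w} T.FullSubcategory) (hN : classX T N) :=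
    hT.isIso_extTorHom (hX N hN)
  refine InduceEquivalence.of_iso (fun M _ => hT.isZero_tensor_extRestr M)
    (fun N _ => (torsionFreeClass_iff _).2
      ((isZero_homRestr_iff T _).1 (hT.isZero_homRestr_tor N)))
    (fun M hM => (@asIso _ _ _ _ _ (hiso M hM)).symm)
    (fun M M' hM hM' f => ?_)
    (fun N hN => (@asIso _ _ _ _ _ (hiso' N hN)).symm)
    (fun N N' hN hN' f => ?_)
  -- The chosen embeddings are not functorial, but `f` extends to some morphism between them, which
  -- is enough for naturality.
  · obtain ⟨g, hg⟩ := hext M hM (E M' hM') (f ≫ i M' hM') (hE M' hM')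
    have := (hS M hM).epi_g
    have hw : i M hM ≫ g ≫ p M' hM' = 0 := by
      rw [reassoc_of% hg, w, comp_zero]
    let φ : ShortComplex.mk (i M hM) (p M hM) (w M hM) ⟶
        ShortComplex.mk (i M' hM') (p M' hM') (w M' hM') :=
      { τ₁ := f
        τ₂ := g
        τ₃ := (hS M hM).exact.desc _ hw
        comm₁₂ := hg.symm
        comm₂₃ := ((hS M hM).exact.g_desc _ hw).symm }
    have := hiso M hM
    have := hiso M' hM'
    simp only [Iso.symm_hom, asIso_inv]
    rw [IsIso.comp_inv_eq, Category.assoc,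
      torExtHom_naturality (hS M hM) (h M hM) (hS M' hM') (h M' hM') φ, IsIso.inv_hom_id_assoc]
  -- Here the cover of `N` is projective, so `f` lifts to the cover sequences.
  · obtain ⟨φ, rfl⟩ := (coverComplex_shortExact N').exists_hom_of_projective (S := coverComplex N) f
    have := hiso' N hN
    have := hiso' N' hN'
    simp only [Iso.symm_hom, asIso_inv]
    rw [IsIso.comp_inv_eq, Category.assoc,
      extTorHom_naturality _ (hX N hN) _ (hX N' hN') φ, IsIso.inv_hom_id_assoc]

end CatMod

theorem mainTheorem1 {C : Type u} [Category.{v} C] [Preadditive C] [EssentiallySmall.{w} C]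
    (T : ObjectProperty (CatMod.{w} C)) [EssentiallySmall.{w} T.FullSubcategory]
    (hT : CatMod.IsTilting T) :
    InduceEquivalence (CatMod.torsionClass T) (CatMod.classY T)
      (CatMod.homRestr T) (CatMod.tensor T) ∧
    InduceEquivalence (CatMod.torsionFreeClass T) (CatMod.classX T)
      (CatMod.extRestr T 1) (CatMod.tor T 1) ∧
    (∀ N, IsZero ((CatMod.homRestr T).obj ((CatMod.tor T 1).obj N))) ∧
    (∀ N, IsZero ((CatMod.extRestr T 1).obj ((CatMod.tensor T).obj N))) ∧
    (∀ M, IsZero ((CatMod.tor T 1).obj ((CatMod.homRestr T).obj M))) ∧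
    (∀ M, IsZero ((CatMod.tensor T).obj ((CatMod.extRestr T 1).obj M))) ∧
    IsTorsionTheory (CatMod.classX T) (CatMod.classY T) :=
  ⟨hT.induceEquivalence_homRestr_tensor, hT.induceEquivalence_extRestr_tor,
    hT.isZero_homRestr_tor, hT.isZero_extRestr_tensor, hT.isZero_tor_homRestr,
    hT.isZero_tensor_extRestr, hT.isTorsionTheory⟩
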